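/- **Setting.** Let $n\ge 1$ and $\alpha>\frac1{n+2}$. Let $\theta$ be the surface area measure on the unit sphere $\mathbb S^n\subset\mathbb R^{n+1}$, let $\omega_n=\theta(\mathbb S^n)$, and let $\sigma=\frac1{\omega_n}\theta$ be the normalized (probability) measure. For a convex body $\Omega\subset\mathbb R^{n+1}$ and $z\in\Omega$ let $u_z(x)=\sup_{y\in\Omega}\langle y-z,x\rangle$, and let $$\mathcal E_{\alpha,f}(\Omega)=\sup_{z\in\Omega}\mathcal E_{\alpha,f}(\Omega,z),\qquad \mathcal E_{\alpha,f}(\Omega,z)=\begin{cases}\frac{\alpha}{\alpha-1}\log \int_{\mathbb S^n} u_z^{1-\frac1\alpha} f\,d\sigma,&\alpha\ne1,\\ \int_{\mathbb S^n} f\log u_z\,d\sigma,&\alpha=1,\end{cases}$$ where $\mathcal E_{\alpha,f}(\Omega,z)=-\infty$ is allowed for $z\in\partial\Omega$. For a linear subspace $L\subset\mathbb R^{n+1}$ with $1\le\dim L\le n$ and $\delta\in(0,1)$ let $$\Psi(L\cap\mathbb S^n,\delta)=\{x\in\mathbb S^n:\langle x,y\rangle\le\delta\ \text{ for all } y\in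 L^\perp\cap\mathbb S^n\}.$$ **Theorem 2.1.** Let $f$ be a bounded measurable function on $\mathbb S^n$ with $\inf f>0$ and $\int_{\mathbb S^n}f\,d\sigma=1$. Let $\Omega\subset\mathbb R^{n+1}$ be a convex body with $|\Omega|=|B(1)|$, where $B(1)$ is the unit ball, and with diameter $D$. Let $u=u_c$ be its support function with respect to its centroid $c$. Let $\delta,\tau\in(0,1)$. (i) If $\alpha>1$ and $\int_{\Psi(z^\perp\cap\mathbb S^n,\delta)}f\,d\sigma\le 1-\tau$ for all $z\in\mathbb S^n$, then $$\exp\Big(\tfrac{\alpha-1}{\alpha}\mathcal E_{\alpha,f}(\Omega)\Big)\ \ge\ \gamma_1\,\tau\,\delta^{1-\frac1\alpha}D^{1-\frac1\alpha},$$ where $\gamma_1>0$ depends only on $n$ and $\alpha$. (ii) If $\alpha=1$ and $\int_{\Psi(L\cap\mathbb S^n,\delta)}f\,d\sigma<\frac{(1-\tau)i}{n+1}$ for every linear $i$-subspace $L$ of $\mathbb R^{n+1}$, $i=1,\dots,n$, then $$\mathcal E_{1,f}(\Omega)\ \ge\ \tau\log D+\log\delta-4\log(n+1).$$ (iii) Let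 $\frac1{n+2}<\alpha<1$ and $p=1-\frac1\alpha\in(-n-1,0)$, and suppose that $$\int_{\Psi(z^\perp\cap\mathbb S^n,\delta)}f^{\frac{n+1}{n+1+p}}\,d\sigma\le\tau^{\frac{n+1}{n+1+p}}\quad\text{for all }z\in\mathbb S^n.\qquad(*)$$ If $\tau\le\frac12\int_{\mathbb S^n}f\,u^{1-\frac1\alpha}\,d\sigma$, then either $D\le 16n^2/\delta^2$ or $D\le\big(\frac12\int_{\mathbb S^n}f\,u^{1-\frac1\alpha}\,d\sigma\big)^{2/p}$. Moreover, if $\tau\le\frac12\exp\big(\frac{\alpha-1}{\alpha}\mathcal E_{\alpha,f}(\Omega)\big)$, then either $D\le16n^2/\delta^2$ or $D\le\big(\frac12\exp\big(\frac{\alpha-1}{\alpha}\mathcal E_{\alpha,f}(\Omega)\big)\big)^{2/p}$. Conversely, for every $\alpha>\frac1{n+2}$, every bounded measurable $f$ with $\inf f>0$ and $\int_{\mathbb S^n}f\,d\sigma=1$, and every $\tau\in(0,1)$, there is $\delta\in(0,1)$ such that the conditions on the collars in (i), in (ii), and in $(*)$ (with $p=1-\frac1\alpha$) all hold; and, if $\alpha<1$,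 every convex body $\Omega$ with $|\Omega|=|B(1)|$ and $\tau\le\frac12\exp\big(\frac{\alpha-1}{\alpha}\mathcal E_{\alpha,f}(\Omega)\big)$ also satisfies the condition $\tau\le\frac12\int_{\mathbb S^n}f\,u^{1-\frac1\alpha}\,d\sigma$ in (iii). -/

import Mathlib

open MeasureTheory Metric
open scoped RealInnerProductSpace

noncomputable section

namespace EntropyDiam

/-- The Euclidean space of dimension `n + 1`. -/
abbrev Space (n : ℕ) : Type := EuclideanSpace ℝ (Fin (n + 1))

/-- The unit sphere of dimension `n`. -/
abbrev Sph (n : ℕ) : Type := sphere (0 : Space n) 1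

/-- The rotation-invariant probability measure on the unit sphere: the surface area measure divided
by the total surface area. An averaged integral over a subset of the sphere is always
normalized by the area of the whole sphere, so it is an integral against this measure. -/
def sphProb (n : ℕ) : Measure (Sph n) :=
  ((volume : Measure (Space n)).toSphere Set.univ)⁻¹ • (volume : Measure (Space n)).toSphere

/-- The support function of `K` in direction `x` with respect to the base point `z`. -/
def supportFn {n : ℕ} (K : Set (Space n)) (z : Space n) (x : Sph n) : ℝ :=
  sSup ((fun y : Space n => ⟪y - z, (x : Space n)⟫) '' K)

/-- The averaged integral over the sphere of `f` times the power `1 - 1/α` of the support function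
with base point `z`. It is extended-valued: for `α < 1` it may be infinite when `z` lies
on the boundary. -/
def powerIntegral {n : ℕ} (α : ℝ) (f : Sph n → ℝ) (K : Set (Space n)) (z : Space n) : ENNReal :=
  ∫⁻ x, ENNReal.ofReal (f x) * ENNReal.ofReal (supportFn K z x) ^ (1 - 1 / α) ∂(sphProb n)

/-- The averaged integral over the sphere of `f` times the logarithm of the support function
with base point `z` (positive part minus negative part, where `log 0` is `⊥`). -/
def logIntegral {n : ℕ} (f : Sph n → ℝ) (K : Set (Space n)) (z : Space n) : EReal :=
  ((∫⁻ x, ENNReal.ofReal (f x) *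
      (ENNReal.log (ENNReal.ofReal (supportFn K z x))).toENNReal ∂(sphProb n) : ENNReal) : EReal) -
  ((∫⁻ x, ENNReal.ofReal (f x) *
      (-ENNReal.log (ENNReal.ofReal (supportFn K z x))).toENNReal ∂(sphProb n) : ENNReal) : EReal)

/-- The entropy of `K` with respect to the base point `z`; it may be `⊥` at boundary points. -/
def entropyAt {n : ℕ} (α : ℝ) (f : Sph n → ℝ) (K : Set (Space n)) (z : Space n) : EReal :=
  if α = 1 then logIntegral f K z
  else ((α / (α - 1) : ℝ) : EReal) * ENNReal.log (powerIntegral α f K z)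

/-- The entropy of `K`: the supremum of the entropies with respect to the points of `K`. -/
def entropy {n : ℕ} (α : ℝ) (f : Sph n → ℝ) (K : Set (Space n)) : EReal :=
  ⨆ z ∈ K, entropyAt α f K z

/-- The collar of width `δ` around the great subsphere cut out by the linear subspace `L`. -/
def collar {n : ℕ} (L : Submodule ℝ (Space n)) (δ : ℝ) : Set (Sph n) :=
  {x | ∀ y : Sph n, (y : Space n) ∈ Lᗮ → ⟪(x : Space n), (y : Space n)⟫ ≤ δ}

/-- The centroid of `K`. -/
def centroid {n : ℕ} (K : Set (Space n)) : Space n :=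
  ⨍ y in K, y ∂(volume : Measure (Space n))

/-- Bounded measurable densities with positive infimum and average one. -/
structure IsDensity {n : ℕ} (f : Sph n → ℝ) : Prop where
  aemeasurable : AEMeasurable f (sphProb n)
  bounded : ∃ C : ℝ, ∀ x, f x ≤ C
  inf_pos : ∃ c : ℝ, 0 < c ∧ ∀ x, c ≤ f x
  average : ∫ x, f x ∂(sphProb n) = 1

/-- The convex body `Ω` has the volume of the unit ball (so its interior is nonempty). -/
def HasUnitBallVolume {n : ℕ} (Ω : ConvexBody (Space n)) : Prop :=
  volume (Ω : Set (Space n)) = volume (closedBall (0 : Space n) 1)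

/-- No large concentration of `f` near great subspheres of codimension one. -/
def HyperplaneCondition {n : ℕ} (f : Sph n → ℝ) (τ δ : ℝ) : Prop :=
  ∀ z : Sph n, ∫ x in collar (ℝ ∙ (z : Space n))ᗮ δ, f x ∂(sphProb n) ≤ 1 - τ

/-- No large concentration of `f` near linear subspaces of any dimension `i = 1, …, n`. -/
def SubspaceCondition {n : ℕ} (f : Sph n → ℝ) (τ δ : ℝ) : Prop :=
  ∀ L : Submodule ℝ (Space n), 1 ≤ Module.finrank ℝ L → Module.finrank ℝ L ≤ n →
    ∫ x in collar L δ, f x ∂(sphProb n) < (1 - τ) * (Module.finrank ℝ L : ℝ) / ((n : ℝ) + 1)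

/-- Smallness of `f` near great subspheres in the norm with exponent `(n+1)/(n+1+p)`. -/
def PowerCondition {n : ℕ} (p : ℝ) (f : Sph n → ℝ) (τ δ : ℝ) : Prop :=
  ∀ z : Sph n,
    ∫ x in collar (ℝ ∙ (z : Space n))ᗮ δ, f x ^ (((n : ℝ) + 1) / ((n : ℝ) + 1 + p)) ∂(sphProb n)
      ≤ τ ^ (((n : ℝ) + 1) / ((n : ℝ) + 1 + p))

end EntropyDiam

end

open EntropyDiam

/-!
The entropy is the supremum over base points `z ∈ Ω` of a quantity that is increasing in `u_z` for
`α ≥ 1`, so for `α ≥ 1` a lower bound needs only one good base point. For `α < 1`, the exponential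
of the scaled entropy is an infimum of power integrals over the base points, hence at most the power
integral at the centroid.

* `α > 1` (`ofReal_le_powerIntegral_midpoint`): take `z` to be the midpoint of a diameter with
  direction `e`. Then `u_z(x) ≥ (D / 2) |⟪e, x⟫| ≥ δ D / 2` off the collar of `e^⊥`, whose complement
  carries mass at least `τ`. The constant is `γ = 2 ^ (-(1 - 1/α))`.
* `α = 1` (`le_entropy_one`): an inscribed simplex of maximal volume gives an ellipsoid with
  semi-axes `r_0 ≥ ⋯ ≥ r_n` such that a translate of it lies in `Ω`, while `D` is at most a multiple
  of `r_0` and `∏ r_i` is bounded from below by the volume of `Ω` (`exists_ellipsoid`). Off the collar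
  of the span of the axes `j + 1, …, n`, the support function is at least `δ r_j`. Integrating
  `log u_z` and summing by parts, the bounds on the masses of the collars turn the sum of the
  `log r_j` into `τ log r_0 + (1 - τ) / (n + 1) * log ∏ r_i` (`le_integral_mul_log`).
* `α < 1` (`diam_le_or_of_le_powerIntegral`): on the collar orthogonal to a diameter, Hölder's
  inequality with exponent `(n + 1) / (n + 1 + p)` and the Blaschke–Santaló inequality at the
  centroid, `∫ u_c ^ (-(n + 1)) dσ ≤ 1` (`lintegral_supportFn_rpow_le_one`), bound the contribution
  by `τ`. Off the collar, `u_c ≥ δ D / (n + 2)`, because the width of `Ω` in direction `x` is at most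
  `(n + 2) u_c(x)` (`inner_sub_le_mul_supportFn_centroid`).
* The collars have measure `O(δ)`, uniformly in the subspace, and `f` is bounded, so all conditions
  hold for small `δ` (`exists_width`).

The Blaschke–Santaló inequality is derived from its functional version `functionalSantalo`: if `f`
has barycenter at the origin and `f(x) g(y) ≤ C exp(-⟪x, y⟫)`, then `∫ f ∫ g ≤ C (2π)^n`. This is
proved by induction on the dimension, following Lehec. Cut the mass of one density by a median
hyperplane, choose the direction joining the barycenters of the two halves, and integrate either
half along lines: on the half-lines the one-dimensional Prékopa–Leindler inequality in multiplicative
form (`lintegral_Ioi_mul_le`) applies, and the integrated densities satisfy the hypotheses in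
dimension `n - 1`. The passage to bodies uses `exp(-‖x‖_K² / 2)` and `exp(-h_K² / 2)`, calibrated by
the Euclidean ball.
-/

open EntropyDiam

/-! ### The one-dimensional Prékopa–Leindler inequality -/

lemma volume_add_le_of_isCompact {A B : Set ℝ} (hA : IsCompact A) (hB : IsCompact B)
    (hA0 : A.Nonempty) (hB0 : B.Nonempty) {S : Set ℝ}
    (hS : ∀ a ∈ A, ∀ b ∈ B, a + b ∈ S) : volume A + volume B ≤ volume S := by
  obtain ⟨a, haA, ha⟩ := hA.exists_isGreatest hA0
  obtain ⟨b, hbB, hb⟩ := hB.exists_isLeast hB0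
  have h1 : volume ((fun x => x + b) '' A) = volume A := by
    simp
  have h2 : volume ((fun x => a + x) '' B) = volume B := by
    simp
  have hm : MeasurableSet ((fun x => a + x) '' B) :=
    (hB.image (by fun_prop)).measurableSet
  have hd : AEDisjoint volume ((fun x => x + b) '' A) ((fun x => a + x) '' B) := by
    refine measure_mono_null (t := {a + b}) ?_ (by simp)
    rintro _ ⟨⟨x, hx, rfl⟩, ⟨y, hy, hxy⟩⟩
    have := ha hx
    have := hb hy
    simp only [Set.mem_singleton_iff] at *
    linarith
  rw [← h1, ← h2, ← measure_union₀ hm.nullMeasurableSet hd]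
  refine measure_mono ?_
  rintro _ (⟨x, hx, rfl⟩ | ⟨x, hx, rfl⟩)
  · exact hS _ hx _ hbB
  · exact hS _ haA _ hx

/-- The Brunn–Minkowski inequality on the line. -/
lemma volume_add_le {A B : Set ℝ} (hA : MeasurableSet A) (hB : MeasurableSet B)
    (hA0 : A.Nonempty) (hB0 : B.Nonempty) {S : Set ℝ}
    (hS : ∀ a ∈ A, ∀ b ∈ B, a + b ∈ S) : volume A + volume B ≤ volume S := by
  obtain ⟨a, ha⟩ := hA0
  obtain ⟨b, hb⟩ := hB0
  rw [hA.measure_eq_iSup_isCompact, hB.measure_eq_iSup_isCompact]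
  simp only [iSup_and']
  refine ENNReal.biSup_add_biSup_le' ⟨∅, by simp⟩ ⟨∅, by simp⟩ ?_
  rintro K ⟨hKA, hK⟩ L ⟨hLB, hL⟩
  calc volume K + volume L ≤ volume (K ∪ {a}) + volume (L ∪ {b}) := by
        gcongr <;> exact Set.subset_union_left
    _ ≤ volume S := by
        refine volume_add_le_of_isCompact (hK.union isCompact_singleton)
          (hL.union isCompact_singleton) (by simp) (by simp) ?_
        rintro x (hx | rfl) y (hy | rfl)
        exacts [hS _ (hKA hx) _ (hLB hy), hS _ (hKA hx) _ hb, hS _ ha _ (hLB hy), hS _ ha _ hb]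

lemma four_mul_mul_le_add_sq (a b : ENNReal) : 4 * (a * b) ≤ (a + b) ^ 2 := by
  induction a with
  | top => simp
  | coe a =>
    induction b with
    | top => simp
    | coe b =>
      norm_cast
      rw [← NNReal.coe_le_coe]
      push_cast
      nlinarith [sq_nonneg ((a : ℝ) - b)]

/-- The additive form of the one-dimensional Prékopa–Leindler inequality, for functions with
supremum `1`: their superlevel sets at levels below `1` are nonempty, so the Brunn–Minkowski
inequality applies at every level. -/
lemma lintegral_add_le_of_forall_lt {φ ψ h : ℝ → ℝ} (hφ : Measurable φ) (hψ : Measurable ψ)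
    (hh : Measurable h) (hφ0 : ∀ x, 0 ≤ φ x) (hψ0 : ∀ x, 0 ≤ ψ x) (hh0 : ∀ x, 0 ≤ h x)
    (hφ1 : ∀ x, φ x ≤ 1) (hψ1 : ∀ x, ψ x ≤ 1)
    (hφs : ∀ t < 1, ∃ x, t < φ x) (hψs : ∀ t < 1, ∃ x, t < ψ x)
    (H : ∀ x y, φ x * ψ y ≤ h (x + y) ^ 2) :
    (∫⁻ x, ENNReal.ofReal (φ x)) + ∫⁻ x, ENNReal.ofReal (ψ x) ≤ ∫⁻ x, ENNReal.ofReal (h x) := by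
  rw [lintegral_eq_lintegral_meas_lt _ (.of_forall hφ0) hφ.aemeasurable,
    lintegral_eq_lintegral_meas_lt _ (.of_forall hψ0) hψ.aemeasurable,
    lintegral_eq_lintegral_meas_lt _ (.of_forall hh0) hh.aemeasurable]
  refine (le_lintegral_add _ _).trans (setLIntegral_mono' measurableSet_Ioi fun t ht => ?_)
  simp only [Set.mem_Ioi] at ht
  rcases lt_or_ge t 1 with h1 | h1
  · obtain ⟨x, hx⟩ := hφs t h1
    obtain ⟨y, hy⟩ := hψs t h1
    refine volume_add_le (measurableSet_lt measurable_const hφ)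
      (measurableSet_lt measurable_const hψ) ⟨x, hx⟩ ⟨y, hy⟩ fun a ha b hb => ?_
    simp only [Set.mem_ofPred_eq] at ha hb ⊢
    refine lt_of_pow_lt_pow_left₀ 2 (hh0 _) (lt_of_lt_of_le ?_ (H a b))
    nlinarith
  · have h2 : {a | t < φ a} = ∅ := by
      ext a; simpa using (hφ1 a).trans h1
    have h3 : {a | t < ψ a} = ∅ := by
      ext a; simpa using (hψ1 a).trans h1
    simp [h2, h3]

/-- The one-dimensional Prékopa–Leindler inequality with weight one half; the usual argument
`(x + y) / 2` of `h` is rescaled to `x + y`. -/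
lemma four_mul_lintegral_mul_le {φ ψ h : ℝ → ℝ} (hφ : Measurable φ) (hψ : Measurable ψ)
    (hh : Measurable h) (hφ0 : ∀ x, 0 ≤ φ x) (hψ0 : ∀ x, 0 ≤ ψ x) (hh0 : ∀ x, 0 ≤ h x)
    (hφb : BddAbove (Set.range φ)) (hψb : BddAbove (Set.range ψ))
    (H : ∀ x y, φ x * ψ y ≤ h (x + y) ^ 2) :
    4 * ((∫⁻ x, ENNReal.ofReal (φ x)) * ∫⁻ x, ENNReal.ofReal (ψ x)) ≤
      (∫⁻ x, ENNReal.ofReal (h x)) ^ 2 := by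
  by_cases hz : ∀ x, φ x = 0
  · simp [hz]
  by_cases hz' : ∀ x, ψ x = 0
  · simp [hz']
  push Not at hz hz'
  obtain ⟨x₀, hx₀⟩ := hz
  obtain ⟨y₀, hy₀⟩ := hz'
  set a := ⨆ x, φ x with ha
  set b := ⨆ x, ψ x with hb
  have ha0 : 0 < a := ((hφ0 x₀).lt_of_ne' hx₀).trans_le (le_ciSup hφb x₀)
  have hb0 : 0 < b := ((hψ0 y₀).lt_of_ne' hy₀).trans_le (le_ciSup hψb y₀)
  set c := Real.sqrt (a * b) with hc
  have hc0 : 0 < c := Real.sqrt_pos.2 (mul_pos ha0 hb0)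
  have hc2 : c ^ 2 = a * b := Real.sq_sqrt (mul_pos ha0 hb0).le
  have key := lintegral_add_le_of_forall_lt (φ := fun x => φ x / a) (ψ := fun x => ψ x / b)
    (h := fun x => h x / c) (by fun_prop) (by fun_prop) (by fun_prop)
    (fun x => div_nonneg (hφ0 x) ha0.le) (fun x => div_nonneg (hψ0 x) hb0.le)
    (fun x => div_nonneg (hh0 x) hc0.le)
    (fun x => (div_le_one ha0).2 (le_ciSup hφb x)) (fun x => (div_le_one hb0).2 (le_ciSup hψb x))
    (fun t ht => by
      obtain ⟨x, hx⟩ := exists_lt_of_lt_ciSup (show t * a < ⨆ x, φ x by rw [← ha]; nlinarith)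
      exact ⟨x, (lt_div_iff₀ ha0).2 hx⟩)
    (fun t ht => by
      obtain ⟨x, hx⟩ := exists_lt_of_lt_ciSup (show t * b < ⨆ x, ψ x by rw [← hb]; nlinarith)
      exact ⟨x, (lt_div_iff₀ hb0).2 hx⟩)
    (fun x y => by
      rw [div_pow, hc2, div_mul_div_comm]
      exact div_le_div_of_nonneg_right (H x y) (mul_pos ha0 hb0).le)
  have hscale : ∀ (F : ℝ → ℝ) (r : ℝ), 0 < r → (∫⁻ x, ENNReal.ofReal (F x)) =
      ENNReal.ofReal r * ∫⁻ x, ENNReal.ofReal (F x / r) := by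
    intro F r hr
    rw [← lintegral_const_mul' _ _ ENNReal.ofReal_ne_top]
    refine lintegral_congr fun x => ?_
    rw [← ENNReal.ofReal_mul hr.le, mul_div_cancel₀ _ hr.ne']
  rw [hscale φ a ha0, hscale ψ b hb0, hscale h c hc0, mul_pow, ← ENNReal.ofReal_pow hc0.le, hc2,
    ENNReal.ofReal_mul ha0.le]
  calc _ = ENNReal.ofReal a * ENNReal.ofReal b *
        (4 * ((∫⁻ x, ENNReal.ofReal (φ x / a)) * ∫⁻ x, ENNReal.ofReal (ψ x / b))) := by ring
    _ ≤ _ := by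
      gcongr
      exact (four_mul_mul_le_add_sq _ _).trans (by gcongr)

lemma lintegral_Ioi_eq_lintegral_exp (φ : ℝ → ENNReal) :
    ∫⁻ s in Set.Ioi 0, φ s = ∫⁻ a, ENNReal.ofReal (Real.exp a) * φ (Real.exp a) := by
  have := lintegral_image_eq_lintegral_abs_deriv_mul (f := Real.exp) (f' := Real.exp)
    MeasurableSet.univ (fun x _ => (Real.hasDerivAt_exp x).hasDerivWithinAt)
    Real.exp_injective.injOn φ
  rw [Set.image_univ, Real.range_exp] at this
  simpa [abs_of_pos (Real.exp_pos _)] using this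

lemma lintegral_Ioi_inv_sqrt_mul_exp :
    ∫⁻ s in Set.Ioi (0 : ℝ), ENNReal.ofReal (s ^ (-(1 / 2) : ℝ) * Real.exp (-(s / 2))) =
      ENNReal.ofReal (Real.sqrt (2 * Real.pi)) := by
  have h := Real.integral_rpow_mul_exp_neg_mul_Ioi (a := 1 / 2) (r := 1 / 2)
    (by norm_num) (by norm_num)
  have hval : ((1 : ℝ) / (1 / 2)) ^ ((1 : ℝ) / 2) * Real.Gamma (1 / 2) =
      Real.sqrt (2 * Real.pi) := by
    rw [Real.Gamma_one_half_eq, Real.sqrt_mul (by norm_num), Real.sqrt_eq_rpow 2]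
    norm_num
  rw [hval] at h
  have hfun : ∀ t : ℝ, t ^ ((1 : ℝ) / 2 - 1) * Real.exp (-(1 / 2 * t)) =
      t ^ (-(1 / 2) : ℝ) * Real.exp (-(t / 2)) := fun t => by
    norm_num
    ring_nf
    simp
  simp only [hfun] at h
  rw [← h, ofReal_integral_eq_lintegral_ofReal]
  · by_contra hn
    rw [integral_undef hn] at h
    exact (Real.sqrt_pos.2 (mul_pos two_pos Real.pi_pos)).ne h
  · filter_upwards [ae_restrict_mem measurableSet_Ioi] with t ht
    have : (0 : ℝ) < t := ht
    positivity

lemma lintegral_exp_half :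
    ∫⁻ x : ℝ, ENNReal.ofReal (Real.exp (x / 2) * Real.exp (-(Real.exp x / 2))) =
      ENNReal.ofReal (Real.sqrt (2 * Real.pi)) := by
  rw [← lintegral_Ioi_inv_sqrt_mul_exp, lintegral_Ioi_eq_lintegral_exp]
  refine lintegral_congr fun x => ?_
  rw [← ENNReal.ofReal_mul (Real.exp_pos _).le, ← mul_assoc, ← Real.exp_mul, ← Real.exp_add,
    ← Real.exp_add, ← Real.exp_add]
  ring_nf

lemma iSup_lintegral_min_natCast {X : Type*} [MeasurableSpace X] {μ : Measure X}
    {φ : X → ENNReal} (hφ : Measurable φ) :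
    ∫⁻ x, φ x ∂μ = ⨆ N : ℕ, ∫⁻ x, min (φ x) N ∂μ := by
  rw [← lintegral_iSup (f := fun (N : ℕ) x => min (φ x) N) (fun N => by fun_prop)
    (fun N M hNM x => min_le_min_left _ (by exact_mod_cast hNM))]
  refine lintegral_congr fun x => ?_
  rw [← inf_iSup_eq, ENNReal.iSup_natCast, inf_top_eq]

/-- The multiplicative form of the Prékopa–Leindler inequality on the half-line, obtained by the
substitution `s = exp a`, for the kernel `exp (-(s * t))`. The constant `π / 2` is the square of
the integral of `exp (-s² / 2)`. -/
lemma lintegral_Ioi_mul_le {φ ψ : ℝ → ENNReal} (hφ : Measurable φ) (hψ : Measurable ψ)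
    (C : ENNReal)
    (H : ∀ s, 0 < s → ∀ t, 0 < t → φ s * ψ t ≤ C * ENNReal.ofReal (Real.exp (-(s * t)))) :
    (∫⁻ s in Set.Ioi 0, φ s) * (∫⁻ t in Set.Ioi 0, ψ t) ≤ C * ENNReal.ofReal (Real.pi / 2) := by
  rcases eq_or_ne C ⊤ with rfl | hC
  · rw [ENNReal.top_mul (by simp [Real.pi_pos])]
    exact le_top
  rw [lintegral_Ioi_eq_lintegral_exp, lintegral_Ioi_eq_lintegral_exp,
    iSup_lintegral_min_natCast (by fun_prop), iSup_lintegral_min_natCast (by fun_prop)]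
  -- truncation, since the additive form is for bounded functions
  refine ENNReal.mul_le_of_forall_lt fun A hA B hB => ?_
  obtain ⟨N, hN⟩ := lt_iSup_iff.1 hA
  obtain ⟨M, hM⟩ := lt_iSup_iff.1 hB
  refine (mul_le_mul' hN.le hM.le).trans ?_
  set Φ : ℝ → ENNReal := fun a => min (ENNReal.ofReal (Real.exp a) * φ (Real.exp a)) N with hΦ
  set Ψ : ℝ → ENNReal := fun a => min (ENNReal.ofReal (Real.exp a) * ψ (Real.exp a)) M with hΨ
  have hΦt : ∀ a, Φ a ≠ ⊤ := fun a => ne_top_of_le_ne_top (ENNReal.natCast_ne_top N) (min_le_right _ _)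
  have hΨt : ∀ a, Ψ a ≠ ⊤ := fun a => ne_top_of_le_ne_top (ENNReal.natCast_ne_top M) (min_le_right _ _)
  have hΦm : Measurable Φ := by fun_prop
  have hΨm : Measurable Ψ := by fun_prop
  set h : ℝ → ℝ := fun x =>
    Real.sqrt C.toReal * (Real.exp (x / 2) * Real.exp (-(Real.exp x / 2))) with hh
  have hmul : ∀ a b, Φ a * Ψ b ≤
      C * ENNReal.ofReal (Real.exp (a + b) * Real.exp (-(Real.exp (a + b)))) := by
    intro a b
    calc Φ a * Ψ b ≤ (ENNReal.ofReal (Real.exp a) * φ (Real.exp a)) *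
          (ENNReal.ofReal (Real.exp b) * ψ (Real.exp b)) :=
          mul_le_mul' (min_le_left _ _) (min_le_left _ _)
      _ = ENNReal.ofReal (Real.exp (a + b)) * (φ (Real.exp a) * ψ (Real.exp b)) := by
          rw [Real.exp_add, ENNReal.ofReal_mul (Real.exp_pos _).le]; ring
      _ ≤ ENNReal.ofReal (Real.exp (a + b)) *
          (C * ENNReal.ofReal (Real.exp (-(Real.exp a * Real.exp b)))) := by
          exact mul_le_mul_right (H _ (Real.exp_pos _) _ (Real.exp_pos _)) _
      _ = _ := by
          rw [← Real.exp_add, ENNReal.ofReal_mul (Real.exp_pos _).le]; ring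
  have key := four_mul_lintegral_mul_le (φ := fun a => (Φ a).toReal) (ψ := fun a => (Ψ a).toReal)
    (h := h) hΦm.ennreal_toReal hΨm.ennreal_toReal (by fun_prop) (fun _ => ENNReal.toReal_nonneg)
    (fun _ => ENNReal.toReal_nonneg) (fun x => by positivity)
    ⟨N, by
      rintro _ ⟨a, rfl⟩
      exact ENNReal.toReal_le_of_le_ofReal (Nat.cast_nonneg N) (by simp [hΦ])⟩
    ⟨M, by
      rintro _ ⟨a, rfl⟩
      exact ENNReal.toReal_le_of_le_ofReal (Nat.cast_nonneg M) (by simp [hΨ])⟩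
    (fun a b => by
      have := ENNReal.toReal_mono (ENNReal.mul_ne_top hC ENNReal.ofReal_ne_top) (hmul a b)
      rw [ENNReal.toReal_mul, ENNReal.toReal_mul, ENNReal.toReal_ofReal (by positivity)] at this
      refine this.trans_eq ?_
      simp only [hh]
      rw [mul_pow, Real.sq_sqrt ENNReal.toReal_nonneg, mul_pow, ← Real.exp_nat_mul,
        ← Real.exp_nat_mul]
      congr 3 <;> (push_cast; ring_nf))
  simp only [ENNReal.ofReal_toReal (hΦt _), ENNReal.ofReal_toReal (hΨt _)] at key
  have hI : (∫⁻ x, ENNReal.ofReal (h x)) ^ 2 = 4 * (C * ENNReal.ofReal (Real.pi / 2)) := by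
    have : ∀ x, ENNReal.ofReal (h x) = ENNReal.ofReal (Real.sqrt C.toReal) *
        ENNReal.ofReal (Real.exp (x / 2) * Real.exp (-(Real.exp x / 2))) :=
      fun x => ENNReal.ofReal_mul (Real.sqrt_nonneg _)
    simp only [this]
    rw [lintegral_const_mul' _ _ ENNReal.ofReal_ne_top, lintegral_exp_half, mul_pow,
      ← ENNReal.ofReal_pow (Real.sqrt_nonneg _), ← ENNReal.ofReal_pow (Real.sqrt_nonneg _),
      Real.sq_sqrt ENNReal.toReal_nonneg, Real.sq_sqrt (by positivity), ENNReal.ofReal_toReal hC,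
      show 2 * Real.pi = 4 * (Real.pi / 2) by ring, ENNReal.ofReal_mul (by norm_num)]
    simp only [ENNReal.ofReal_ofNat]
    ring
  rw [hI] at key
  exact (ENNReal.mul_le_mul_iff_right (by norm_num) (by norm_num)).1 key

/-! ### The functional Santaló inequality -/

/-- The functional Santaló inequality in dimension `n`, for a density `f` with barycenter at the
origin and an arbitrary function `g` dominated by the polar of `f`. The barycenter is expressed
through the finite measure with density `f`. -/
def FunctionalSantalo (n : ℕ) : Prop :=
  ∀ (C : ENNReal) (f g : (Fin n → ℝ) → ENNReal), Measurable f → Measurable g →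
    ∫⁻ x, f x ≠ ⊤ → (∀ i, Integrable (fun x => x i) (volume.withDensity f)) →
    (∀ i, ∫ x, x i ∂(volume.withDensity f) = 0) →
    (∀ x y, f x * g y ≤ C * ENNReal.ofReal (Real.exp (-(x ⬝ᵥ y)))) →
    (∫⁻ x, f x) * (∫⁻ y, g y) ≤ C * ENNReal.ofReal ((2 * Real.pi) ^ n)

lemma measurable_dotProduct_const {n : ℕ} (w : Fin n → ℝ) :
    Measurable fun y : Fin n → ℝ => w ⬝ᵥ y := by
  unfold dotProduct
  fun_prop

/-- Integrating out the lines with direction `(1, w)` in a half-space turns the measure with density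
`k` into its image under the projection along these lines. -/
lemma lintegral_mul_lintegral_line {n : ℕ} {k : ℝ × (Fin n → ℝ) → ENNReal} (hk : Measurable k)
    (m : ℝ) (z w : Fin n → ℝ) {φ : (Fin n → ℝ) → ENNReal} (hφ : Measurable φ) :
    ∫⁻ y, φ y * ∫⁻ s in Set.Ioi 0, k (m + s, z + y + s • w) =
      ∫⁻ x in {x | m < x.1}, k x * φ (x.2 - z - (x.1 - m) • w) := by
  have hS : MeasurableSet {x : ℝ × (Fin n → ℝ) | m < x.1} :=
    measurableSet_lt measurable_const measurable_fst
  have h1 : ∀ y, φ y * ∫⁻ s in Set.Ioi 0, k (m + s, z + y + s • w) =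
      ∫⁻ s in Set.Ioi 0, φ y * k (m + s, z + y + s • w) := fun y => by
    rw [lintegral_const_mul _ (by fun_prop)]
  simp only [h1]
  rw [lintegral_lintegral_swap (by fun_prop)]
  have h2 : ∀ s, ∫⁻ y, φ y * k (m + s, z + y + s • w) =
      ∫⁻ y, φ (y - z - s • w) * k (m + s, y) := fun s => by
    rw [← lintegral_add_right_eq_self (fun y => φ (y - z - s • w) * k (m + s, y)) (z + s • w)]
    refine lintegral_congr fun y => ?_
    congr 2
    · abel
    · rw [show z + y + s • w = y + (z + s • w) by abel]
  simp only [h2]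
  rw [← lintegral_indicator measurableSet_Ioi, ← lintegral_indicator hS, Measure.volume_eq_prod,
    lintegral_prod _ (by fun_prop (disch := measurability)),
    ← lintegral_add_right_eq_self _ (-m)]
  refine lintegral_congr fun s => ?_
  by_cases hs : m < s
  · have : s + -m ∈ Set.Ioi (0 : ℝ) := by simpa using hs
    rw [Set.indicator_of_mem this]
    refine lintegral_congr fun y => ?_
    rw [Set.indicator_of_mem (by simpa using hs), mul_comm]
    simp [sub_eq_add_neg]
  · have : s + -m ∉ Set.Ioi (0 : ℝ) := by simpa using hs
    rw [Set.indicator_of_notMem this]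
    symm
    simp [Set.indicator, hs]

/-- One half-space in the induction: integrate along the direction `(1, w)` on the primal side,
along the first coordinate on the dual side, and apply the inequality in dimension `n`. -/
lemma FunctionalSantalo.halfSpace {n : ℕ} (hP : FunctionalSantalo n) {C : ENNReal}
    {k f : ℝ × (Fin n → ℝ) → ENNReal} (hk : Measurable k) (hf : Measurable f)
    (hfin : ∫⁻ x, k x ≠ ⊤) (m : ℝ) (z w : Fin n → ℝ)
    (hint : ∀ i, Integrable (fun x : ℝ × (Fin n → ℝ) => x.2 i - z i - (x.1 - m) * w i)
      ((volume.withDensity k).restrict {x | m < x.1}))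
    (hbar : ∀ i, ∫ x in {x | m < x.1}, (x.2 i - z i - (x.1 - m) * w i)
      ∂(volume.withDensity k) = 0)
    (H : ∀ x ξ, k x * f ξ ≤
      C * ENNReal.ofReal (Real.exp (-((x.1 - m) * ξ.1 + (x.2 - z) ⬝ᵥ ξ.2)))) :
    (∫⁻ x in {x | m < x.1}, k x) * (∫⁻ ξ in {ξ | 0 < ξ.1 + w ⬝ᵥ ξ.2}, f ξ) ≤
      C * ENNReal.ofReal (Real.pi / 2) * ENNReal.ofReal ((2 * Real.pi) ^ n) := by
  have hw := measurable_dotProduct_const w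
  have hS : MeasurableSet {x : ℝ × (Fin n → ℝ) | m < x.1} :=
    measurableSet_lt measurable_const measurable_fst
  set F : (Fin n → ℝ) → ENNReal := fun y => ∫⁻ s in Set.Ioi 0, k (m + s, z + y + s • w) with hF
  set G : (Fin n → ℝ) → ENNReal := fun η => ∫⁻ t in Set.Ioi 0, f (t - w ⬝ᵥ η, η) with hG
  have hFm : Measurable F := by
    refine Measurable.lintegral_prod_right' (f := fun p : (Fin n → ℝ) × ℝ =>
      k (m + p.2, z + p.1 + p.2 • w)) (by fun_prop)
  have hGm : Measurable G := by
    refine Measurable.lintegral_prod_right' (f := fun p : (Fin n → ℝ) × ℝ =>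
      f (p.2 - w ⬝ᵥ p.1, p.1)) (by fun_prop)
  have hproj : Measurable fun x : ℝ × (Fin n → ℝ) => x.2 - z - (x.1 - m) • w := by fun_prop
  have hmap : volume.withDensity F =
      ((volume.withDensity k).restrict {x | m < x.1}).map
        (fun x => x.2 - z - (x.1 - m) • w) := by
    ext A hA
    have := lintegral_mul_lintegral_line hk m z w (φ := A.indicator 1)
      (measurable_one.indicator hA)
    rw [withDensity_apply _ hA, Measure.map_apply hproj hA, restrict_withDensity hS,
      withDensity_apply _ (hproj hA), ← lintegral_indicator hA,
      ← lintegral_indicator (hproj hA)]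
    calc _ = ∫⁻ y, A.indicator 1 y * F y := by
          refine lintegral_congr fun y => ?_
          by_cases hy : y ∈ A <;> simp [hy]
      _ = _ := by
          rw [this]
          refine lintegral_congr fun x => ?_
          by_cases hx : x.2 - z - (x.1 - m) • w ∈ A <;> simp [hx]
  have hFint : ∫⁻ y, F y = ∫⁻ x in {x | m < x.1}, k x := by
    simpa using lintegral_mul_lintegral_line hk m z w (φ := 1) measurable_one
  have hGint : ∫⁻ η, G η = ∫⁻ ξ in {ξ | 0 < ξ.1 + w ⬝ᵥ ξ.2}, f ξ := by
    rw [← lintegral_indicator (measurableSet_lt measurable_const (by fun_prop)),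
      Measure.volume_eq_prod, lintegral_prod_symm _
        (hf.indicator (measurableSet_lt measurable_const (by fun_prop))).aemeasurable]
    refine lintegral_congr fun η => ?_
    simp only [hG]
    rw [← lintegral_indicator measurableSet_Ioi, ← lintegral_add_right_eq_self _ (w ⬝ᵥ η)]
    refine lintegral_congr fun t => ?_
    by_cases ht : 0 < t + w ⬝ᵥ η
    · rw [Set.indicator_of_mem (by simpa using ht), Set.indicator_of_mem (by simpa using ht)]
      simp
    · rw [Set.indicator_of_notMem (by simpa using ht), Set.indicator_of_notMem (by simpa using ht)]
  rw [← hFint, ← hGint]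
  refine hP (C * ENNReal.ofReal (Real.pi / 2)) F G hFm hGm ?_ ?_ ?_ ?_
  · rw [hFint]
    exact ne_top_of_le_ne_top hfin (setLIntegral_le_lintegral _ _)
  · intro i
    rw [hmap, integrable_map_measure (measurable_pi_apply i).aestronglyMeasurable hproj.aemeasurable]
    exact hint i
  · intro i
    rw [hmap, integral_map hproj.aemeasurable (measurable_pi_apply i).aestronglyMeasurable]
    exact hbar i
  · intro y η
    have := lintegral_Ioi_mul_le (φ := fun s => k (m + s, z + y + s • w))
      (ψ := fun t => f (t - w ⬝ᵥ η, η)) (by fun_prop) (by fun_prop)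
      (C * ENNReal.ofReal (Real.exp (-(y ⬝ᵥ η)))) (fun s _ t _ => by
        refine (H _ _).trans_eq ?_
        rw [mul_assoc, ← ENNReal.ofReal_mul (Real.exp_pos _).le, ← Real.exp_add]
        congr 3
        have : z + y + s • w - z = y + s • w := by abel
        simp only [this, add_dotProduct, smul_dotProduct, smul_eq_mul]
        ring)
    refine this.trans_eq ?_
    ring

/-- The distribution function of a measure without atoms attains half of the total mass. -/
lemma exists_median (μ : Measure ℝ) [IsFiniteMeasure μ] [NullSingletonClass μ] :
    ∃ m, μ (Set.Ioi m) = μ Set.univ / 2 ∧ μ (Set.Iio m) = μ Set.univ / 2 := by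
  rcases eq_or_ne (μ Set.univ) 0 with h0 | h0
  · rw [Measure.measure_univ_eq_zero] at h0
    exact ⟨0, by simp [h0]⟩
  have hpos : 0 < μ.real Set.univ := ENNReal.toReal_pos h0 (measure_ne_top _ _)
  have hcont : Continuous fun b => μ.real (Set.Iic b) := by
    have h := intervalIntegral.continuous_primitive (μ := μ) (f := fun _ : ℝ => (1 : ℝ))
      (fun a b => intervalIntegrable_const) 0
    have h2 : (fun b => μ.real (Set.Iic b)) =
        fun b => (∫ _ in (0 : ℝ)..b, (1 : ℝ) ∂μ) + μ.real (Set.Iic 0) := by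
      ext b
      rw [← intervalIntegral.integral_Iic_sub_Iic (integrable_const _).integrableOn
        (integrable_const _).integrableOn]
      simp
    rw [h2]
    exact h.add continuous_const
  have htop : Filter.Tendsto (fun b => μ.real (Set.Iic b)) Filter.atTop (nhds (μ.real Set.univ)) :=
    (ENNReal.tendsto_toReal (measure_ne_top _ _)).comp (tendsto_measure_Iic_atTop μ)
  have hbot : Filter.Tendsto (fun b => μ.real (Set.Ici b)) Filter.atBot (nhds (μ.real Set.univ)) :=
    (ENNReal.tendsto_toReal (measure_ne_top _ _)).comp (tendsto_measure_Ici_atBot μ)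
  obtain ⟨b, hb⟩ := (htop.eventually (lt_mem_nhds (half_lt_self hpos))).exists
  obtain ⟨a, ha⟩ := (hbot.eventually (lt_mem_nhds (half_lt_self hpos))).exists
  have hcompl : ∀ c, μ.real (Set.Ioi c) = μ.real Set.univ - μ.real (Set.Iic c) := fun c => by
    rw [← Set.compl_Iic, measureReal_compl measurableSet_Iic]
  have ha' : μ.real (Set.Ici a) = μ.real (Set.Ioi a) := by
    rw [measureReal_def, measureReal_def, measure_congr Ioi_ae_eq_Ici]
  obtain ⟨m, hm⟩ := mem_range_of_exists_le_of_exists_ge (c := μ.real Set.univ / 2) hcont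
    ⟨a, by linarith [hcompl a]⟩ ⟨b, hb.le⟩
  have hconv : ∀ s : Set ℝ, μ.real s = μ.real Set.univ / 2 → μ s = μ Set.univ / 2 := fun s hs => by
    rw [← ENNReal.toReal_eq_toReal_iff' (measure_ne_top _ _)
      (ENNReal.div_ne_top (measure_ne_top _ _) two_ne_zero), ENNReal.toReal_div]
    simpa [measureReal_def] using hs
  refine ⟨m, hconv _ ?_, hconv _ ?_⟩
  · simp only at hm
    rw [hcompl, hm]; ring
  · rw [measureReal_def, measure_congr Iio_ae_eq_Iic]
    exact hm

lemma ofReal_integral_le_lintegral {X : Type*} [MeasurableSpace X] {μ : Measure X} {φ : X → ℝ}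
    (hφ : Integrable φ μ) : ENNReal.ofReal (∫ x, φ x ∂μ) ≤ ∫⁻ x, ENNReal.ofReal (φ x) ∂μ := by
  rw [integral_eq_lintegral_pos_part_sub_lintegral_neg_part hφ]
  refine ENNReal.ofReal_le_of_le_toReal (sub_le_self _ ENNReal.toReal_nonneg)

/-- Tilting a measure with barycenter at the origin by an exponential increases its mass. -/
lemma measure_univ_le_lintegral_exp {X : Type*} [MeasurableSpace X] {μ : Measure X}
    [IsFiniteMeasure μ] {φ : X → ℝ} (hφ : Integrable φ μ) (h0 : ∫ x, φ x ∂μ = 0) :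
    μ Set.univ ≤ ∫⁻ x, ENNReal.ofReal (Real.exp (φ x)) ∂μ := by
  calc μ Set.univ = ENNReal.ofReal (∫ x, (φ x + 1) ∂μ) := by
        rw [integral_add hφ (integrable_const _), h0]
        simp
    _ ≤ ∫⁻ x, ENNReal.ofReal (φ x + 1) ∂μ :=
        ofReal_integral_le_lintegral (hφ.add (integrable_const _))
    _ ≤ _ := lintegral_mono fun x => ENNReal.ofReal_le_ofReal (Real.add_one_le_exp _)

/-- There is a point on a median hyperplane `{x.1 = m}` and a direction `(1, w)` through it such
that the barycenters of both halves lie on the line through the point in this direction. -/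
lemma exists_median_line {n : ℕ} (ν : Measure (ℝ × (Fin n → ℝ))) [IsFiniteMeasure ν]
    (hac : ν ≪ volume) (hne : ν ≠ 0) (h1 : Integrable (fun x => x.1) ν)
    (h2 : ∀ i, Integrable (fun x => x.2 i) ν) :
    ∃ (m : ℝ) (z w : Fin n → ℝ), ν {x | m < x.1} = ν Set.univ / 2 ∧
      ν {x | x.1 < m} = ν Set.univ / 2 ∧
      (∀ i, ∫ x in {x | m < x.1}, (x.2 i - z i - (x.1 - m) * w i) ∂ν = 0) ∧
      (∀ i, ∫ x in {x | x.1 < m}, (x.2 i - z i - (x.1 - m) * w i) ∂ν = 0) := by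
  have hna : NullSingletonClass (ν.map Prod.fst) := ⟨fun a => by
    rw [Measure.map_apply measurable_fst (measurableSet_singleton a)]
    refine hac ?_
    rw [show Prod.fst ⁻¹' {a} = ({a} : Set ℝ) ×ˢ (Set.univ : Set (Fin n → ℝ)) by ext; simp,
      Measure.volume_eq_prod, Measure.prod_prod]
    simp⟩
  obtain ⟨m, hm1, hm2⟩ := exists_median (ν.map Prod.fst)
  rw [Measure.map_apply measurable_fst measurableSet_Ioi,
    Measure.map_apply measurable_fst MeasurableSet.univ] at hm1
  rw [Measure.map_apply measurable_fst measurableSet_Iio,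
    Measure.map_apply measurable_fst MeasurableSet.univ] at hm2
  change ν {x | m < x.1} = ν Set.univ / 2 at hm1
  change ν {x | x.1 < m} = ν Set.univ / 2 at hm2
  have hpos : 0 < ν.real Set.univ :=
    ENNReal.toReal_pos (by simpa using hne) (measure_ne_top _ _)
  have hr1 : ν.real {x | m < x.1} = ν.real Set.univ / 2 := by
    simp [measureReal_def, hm1]
  have hr2 : ν.real {x | x.1 < m} = ν.real Set.univ / 2 := by
    simp [measureReal_def, hm2]
  have h1m : Integrable (fun x : ℝ × (Fin n → ℝ) => x.1 - m) ν := h1.sub (integrable_const _)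
  set M := ν.real Set.univ / 2 with hM
  have hM0 : 0 < M := by positivity
  set a := ∫ x in {x | m < x.1}, (x.1 - m) ∂ν with ha
  set b := ∫ x in {x | x.1 < m}, (x.1 - m) ∂ν with hb
  have hS1 : MeasurableSet {x : ℝ × (Fin n → ℝ) | m < x.1} :=
    measurableSet_lt measurable_const measurable_fst
  have hS2 : MeasurableSet {x : ℝ × (Fin n → ℝ) | x.1 < m} :=
    measurableSet_lt measurable_fst measurable_const
  have ha0 : 0 < a := by
    rw [ha, setIntegral_pos_iff_support_of_nonneg_ae _ h1m.integrableOn]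
    · refine lt_of_lt_of_le ?_ (measure_mono (s := {x | m < x.1}) fun x hx => ⟨?_, hx⟩)
      · rw [hm1]
        exact ENNReal.div_pos (by simpa using hne) (by norm_num)
      · exact (sub_pos.2 hx).ne'
    · filter_upwards [ae_restrict_mem hS1] with x hx
      exact (sub_pos.2 hx).le
  have hb0 : b ≤ 0 := by
    refine setIntegral_nonpos hS2 fun x hx => ?_
    exact (sub_neg.2 hx).le
  set P : Fin n → ℝ := fun i => ∫ x in {x | m < x.1}, x.2 i ∂ν with hP
  set Q : Fin n → ℝ := fun i => ∫ x in {x | x.1 < m}, x.2 i ∂ν with hQ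
  -- the two linear equations for `z i` and `w i`
  refine ⟨m, fun i => (P i - a * ((P i - Q i) / (a - b))) / M, fun i => (P i - Q i) / (a - b),
    hm1, hm2, fun i => ?_, fun i => ?_⟩
  · rw [integral_sub, integral_sub, integral_mul_const, setIntegral_const, hr1, smul_eq_mul]
    · change P i - M * _ - a * _ = 0
      field_simp
      ring
    · exact (h2 i).integrableOn
    · exact integrable_const _
    · exact ((h2 i).sub (integrable_const _)).integrableOn
    · exact (h1m.mul_const _).integrableOn
  · rw [integral_sub, integral_sub, integral_mul_const, setIntegral_const, hr2, smul_eq_mul]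
    · change Q i - M * _ - b * _ = 0
      have : a - b ≠ 0 := by linarith
      field_simp
      ring
    · exact (h2 i).integrableOn
    · exact integrable_const _
    · exact ((h2 i).sub (integrable_const _)).integrableOn
    · exact (h1m.mul_const _).integrableOn

/-- The lower half-space version of `FunctionalSantalo.halfSpace`, by reflection in the first
coordinate. -/
lemma FunctionalSantalo.halfSpace_neg {n : ℕ} (hP : FunctionalSantalo n) {C : ENNReal}
    {k f : ℝ × (Fin n → ℝ) → ENNReal} (hk : Measurable k) (hf : Measurable f)
    (hfin : ∫⁻ x, k x ≠ ⊤) (m : ℝ) (z w : Fin n → ℝ)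
    (hint : ∀ i, Integrable (fun x : ℝ × (Fin n → ℝ) => x.2 i - z i - (x.1 - m) * w i)
      ((volume.withDensity k).restrict {x | x.1 < m}))
    (hbar : ∀ i, ∫ x in {x | x.1 < m}, (x.2 i - z i - (x.1 - m) * w i)
      ∂(volume.withDensity k) = 0)
    (H : ∀ x ξ, k x * f ξ ≤
      C * ENNReal.ofReal (Real.exp (-((x.1 - m) * ξ.1 + (x.2 - z) ⬝ᵥ ξ.2)))) :
    (∫⁻ x in {x | x.1 < m}, k x) * (∫⁻ ξ in {ξ | ξ.1 + w ⬝ᵥ ξ.2 < 0}, f ξ) ≤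
      C * ENNReal.ofReal (Real.pi / 2) * ENNReal.ofReal ((2 * Real.pi) ^ n) := by
  have hw := measurable_dotProduct_const w
  set ρ : ℝ × (Fin n → ℝ) → ℝ × (Fin n → ℝ) := fun x => (-x.1, x.2) with hρ
  have hρm : Measurable ρ := by fun_prop
  have hρp : MeasurePreserving ρ volume volume :=
    (Measure.measurePreserving_neg (volume : Measure ℝ)).prod (MeasurePreserving.id volume)
  have hρe : MeasurableEmbedding ρ := by
    refine MeasurableEquiv.measurableEmbedding ⟨⟨ρ, ρ, fun x => by simp [hρ], fun x => by simp [hρ]⟩,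
      hρm, hρm⟩
  have hS : MeasurableSet {x : ℝ × (Fin n → ℝ) | -m < x.1} :=
    measurableSet_lt measurable_const measurable_fst
  have hT : MeasurableSet {x : ℝ × (Fin n → ℝ) | x.1 < m} :=
    measurableSet_lt measurable_fst measurable_const
  have hpre : ρ ⁻¹' {x | x.1 < m} = {x | -m < x.1} := by
    ext x
    simp only [hρ, Set.mem_preimage, Set.mem_ofPred_eq]
    exact neg_lt
  have hpre2 : ρ ⁻¹' {ξ | ξ.1 + w ⬝ᵥ ξ.2 < 0} = {ξ | 0 < ξ.1 + (-w) ⬝ᵥ ξ.2} := by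
    ext x
    simp only [hρ, Set.mem_preimage, Set.mem_ofPred_eq, neg_dotProduct]
    constructor <;> intro h <;> linarith
  have hmap : (volume.withDensity k).restrict {x | x.1 < m} =
      ((volume.withDensity (k ∘ ρ)).restrict {x | -m < x.1}).map ρ := by
    rw [← hpre, ← Measure.restrict_map hρm hT]
    congr 1
    ext A hA
    rw [Measure.map_apply hρm hA, withDensity_apply _ hA, withDensity_apply _ (hρm hA)]
    exact (hρp.setLIntegral_comp_preimage hA hk).symm
  have key := hP.halfSpace (C := C) (k := k ∘ ρ) (f := f ∘ ρ) (hk.comp hρm) (hf.comp hρm)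
    (by rw [show (∫⁻ x, (k ∘ ρ) x) = ∫⁻ x, k x from hρp.lintegral_comp hk]; exact hfin)
    (-m) z (-w)
    (fun i => by
      have h := hint i
      rw [hmap, hρe.integrable_map_iff] at h
      refine h.congr (.of_forall fun x => ?_)
      simp only [hρ, Function.comp_apply, Pi.neg_apply]
      ring)
    (fun i => by
      have h := hbar i
      rw [hmap, hρe.integral_map] at h
      rw [← h]
      refine integral_congr_ae (.of_forall fun x => ?_)
      simp only [hρ, Pi.neg_apply]
      ring)
    (fun x ξ => by
      refine (H (ρ x) (ρ ξ)).trans_eq ?_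
      simp only [hρ]
      congr 4
      ring)
  rw [← hpre, ← hpre2] at key
  have e1 := hρp.setLIntegral_comp_preimage hT hk
  have e2 := hρp.setLIntegral_comp_preimage
    (measurableSet_lt (by fun_prop) measurable_const : MeasurableSet {ξ | ξ.1 + w ⬝ᵥ ξ.2 < 0}) hf
  rw [← e1, ← e2]
  exact key

lemma volume_graph_eq_zero {n : ℕ} (w : Fin n → ℝ) :
    volume {ξ : ℝ × (Fin n → ℝ) | ξ.1 + w ⬝ᵥ ξ.2 = 0} = 0 := by
  have hw := measurable_dotProduct_const w
  rw [Measure.volume_eq_prod, Measure.prod_apply_symm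
    (measurableSet_eq_fun (by fun_prop) measurable_const)]
  refine lintegral_eq_zero_of_ae_eq_zero (.of_forall fun η => ?_)
  refine measure_mono_null (t := {-(w ⬝ᵥ η)}) (fun t ht => ?_) (by simp)
  simp only [Set.mem_preimage, Set.mem_ofPred_eq, Set.mem_singleton_iff] at ht ⊢
  linarith

/-- The induction step when both densities have finite mass and first moments: split the density
`k` by a median hyperplane, apply the half-space version to either half, and add. The barycenter of
`f` at the origin ensures that the tilt of `f` caused by moving the base point does not decrease its
integral. -/
lemma FunctionalSantalo.prod_of_moments {n : ℕ} (hP : FunctionalSantalo n) {C : ENNReal}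
    {f k : ℝ × (Fin n → ℝ) → ENNReal} (hf : Measurable f) (hk : Measurable k)
    (hffin : ∫⁻ x, f x ≠ ⊤) (hf1 : Integrable (fun x => x.1) (volume.withDensity f))
    (hf2 : ∀ i, Integrable (fun x => x.2 i) (volume.withDensity f))
    (hf1' : ∫ x, x.1 ∂(volume.withDensity f) = 0)
    (hf2' : ∀ i, ∫ x, x.2 i ∂(volume.withDensity f) = 0)
    (hkfin : ∫⁻ x, k x ≠ ⊤) (hk1 : Integrable (fun x => x.1) (volume.withDensity k))
    (hk2 : ∀ i, Integrable (fun x => x.2 i) (volume.withDensity k))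
    (H : ∀ x y, f x * k y ≤ C * ENNReal.ofReal (Real.exp (-(x.1 * y.1 + x.2 ⬝ᵥ y.2)))) :
    (∫⁻ x, f x) * (∫⁻ y, k y) ≤ C * ENNReal.ofReal ((2 * Real.pi) ^ (n + 1)) := by
  rcases eq_or_ne (∫⁻ y, k y) 0 with h0 | h0
  · simp [h0]
  have := isFiniteMeasure_withDensity hffin
  have := isFiniteMeasure_withDensity hkfin
  have hkuniv : (volume.withDensity k) Set.univ = ∫⁻ y, k y := by simp
  obtain ⟨m, z, w, hm1, hm2, hb1, hb2⟩ := exists_median_line (volume.withDensity k)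
    (withDensity_absolutelyContinuous _ _)
    (by rw [← Measure.measure_univ_ne_zero, hkuniv]; exact h0) hk1 hk2
  have hw := measurable_dotProduct_const w
  have hz := measurable_dotProduct_const z
  rw [hkuniv, withDensity_apply _ (measurableSet_lt measurable_const measurable_fst)] at hm1
  rw [hkuniv, withDensity_apply _ (measurableSet_lt measurable_fst measurable_const)] at hm2
  have hint : ∀ i, Integrable (fun x : ℝ × (Fin n → ℝ) => x.2 i - z i - (x.1 - m) * w i)
      (volume.withDensity k) := fun i =>
    ((hk2 i).sub (integrable_const _)).sub ((hk1.sub (integrable_const _)).mul_const _)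
  -- translating the primal variable by `(m, z)` tilts the dual density
  set φ : ℝ × (Fin n → ℝ) → ℝ := fun ξ => m * ξ.1 + z ⬝ᵥ ξ.2 with hφ
  have hφm : Measurable φ := by fun_prop
  set F : ℝ × (Fin n → ℝ) → ENNReal := fun ξ => f ξ * ENNReal.ofReal (Real.exp (φ ξ)) with hF
  have hFm : Measurable F := by fun_prop
  have HF : ∀ x ξ, k x * F ξ ≤
      C * ENNReal.ofReal (Real.exp (-((x.1 - m) * ξ.1 + (x.2 - z) ⬝ᵥ ξ.2))) := by
    intro x ξ
    calc k x * F ξ = (f ξ * k x) * ENNReal.ofReal (Real.exp (φ ξ)) := by simp only [hF]; ring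
      _ ≤ _ := mul_le_mul_left (H ξ x) _
      _ = _ := by
        rw [mul_assoc, ← ENNReal.ofReal_mul (Real.exp_pos _).le, ← Real.exp_add]
        congr 3
        simp only [hφ, sub_dotProduct, dotProduct_comm x.2 ξ.2]
        ring
  have key1 := hP.halfSpace hk hFm hkfin m z w (fun i => (hint i).restrict) hb1 HF
  have key2 := hP.halfSpace_neg hk hFm hkfin m z w (fun i => (hint i).restrict) hb2 HF
  rw [hm1] at key1
  rw [hm2] at key2
  have hsplit : ∫⁻ ξ, F ξ = (∫⁻ ξ in {ξ | 0 < ξ.1 + w ⬝ᵥ ξ.2}, F ξ) +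
      ∫⁻ ξ in {ξ | ξ.1 + w ⬝ᵥ ξ.2 < 0}, F ξ := by
    rw [← lintegral_add_compl F (measurableSet_lt measurable_const (by fun_prop) :
      MeasurableSet {ξ : ℝ × (Fin n → ℝ) | 0 < ξ.1 + w ⬝ᵥ ξ.2})]
    congr 1
    refine setLIntegral_congr ?_
    have h := measure_eq_zero_iff_ae_notMem.1 (volume_graph_eq_zero w)
    filter_upwards [h] with ξ hξ
    refine propext ⟨fun h1 => ?_, fun h1 => ?_⟩
    · exact lt_of_le_of_ne (not_lt.1 h1) hξ
    · exact not_lt.2 (le_of_lt h1)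
  have htilt : ∫⁻ ξ, f ξ ≤ ∫⁻ ξ, F ξ := by
    have h1 : ∀ i, Integrable (fun x : ℝ × (Fin n → ℝ) => z i * x.2 i) (volume.withDensity f) :=
      fun i => (hf2 i).const_mul _
    have h2 : Integrable φ (volume.withDensity f) :=
      (hf1.const_mul m).add (integrable_finsetSum _ fun i _ => h1 i)
    have h3 : ∫ x, φ x ∂(volume.withDensity f) = 0 := by
      simp only [hφ, dotProduct]
      rw [integral_add (hf1.const_mul m) (integrable_finsetSum _ fun i _ => h1 i),
        integral_finsetSum _ fun i _ => h1 i, integral_const_mul, hf1']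
      simp [integral_const_mul, hf2']
    have h4 := measure_univ_le_lintegral_exp h2 h3
    rw [lintegral_withDensity_eq_lintegral_mul _ hf (by fun_prop)] at h4
    simpa using h4
  set K := ∫⁻ y, k y with hK
  calc (∫⁻ x, f x) * K ≤ (∫⁻ ξ, F ξ) * K := by gcongr
    _ = 2 * (K / 2 * (∫⁻ ξ in {ξ | 0 < ξ.1 + w ⬝ᵥ ξ.2}, F ξ) +
        K / 2 * ∫⁻ ξ in {ξ | ξ.1 + w ⬝ᵥ ξ.2 < 0}, F ξ) := by
        rw [← mul_add, ← hsplit, ← mul_assoc, ENNReal.mul_div_cancel two_ne_zero (by norm_num),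
          mul_comm]
    _ ≤ 2 * (C * ENNReal.ofReal (Real.pi / 2) * ENNReal.ofReal ((2 * Real.pi) ^ n) +
        C * ENNReal.ofReal (Real.pi / 2) * ENNReal.ofReal ((2 * Real.pi) ^ n)) := by gcongr
    _ = C * ENNReal.ofReal ((2 * Real.pi) ^ (n + 1)) := by
        rw [pow_succ', show 2 * Real.pi * (2 * Real.pi) ^ n =
          4 * (Real.pi / 2) * (2 * Real.pi) ^ n by ring,
          ENNReal.ofReal_mul (by positivity), ENNReal.ofReal_mul (by norm_num)]
        simp only [ENNReal.ofReal_ofNat]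
        ring

/-- The induction step; moments of `g` are not needed, by truncation. -/
lemma FunctionalSantalo.prod {n : ℕ} (hP : FunctionalSantalo n) {C : ENNReal}
    {f g : ℝ × (Fin n → ℝ) → ENNReal} (hf : Measurable f) (hg : Measurable g)
    (hffin : ∫⁻ x, f x ≠ ⊤) (hf1 : Integrable (fun x => x.1) (volume.withDensity f))
    (hf2 : ∀ i, Integrable (fun x => x.2 i) (volume.withDensity f))
    (hf1' : ∫ x, x.1 ∂(volume.withDensity f) = 0)
    (hf2' : ∀ i, ∫ x, x.2 i ∂(volume.withDensity f) = 0)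
    (H : ∀ x y, f x * g y ≤ C * ENNReal.ofReal (Real.exp (-(x.1 * y.1 + x.2 ⬝ᵥ y.2)))) :
    (∫⁻ x, f x) * (∫⁻ y, g y) ≤ C * ENNReal.ofReal ((2 * Real.pi) ^ (n + 1)) := by
  -- truncate `g` to make it bounded with bounded support
  set B : ℕ → Set (ℝ × (Fin n → ℝ)) := fun N => closedBall 0 N with hB
  have hBm : ∀ N, MeasurableSet (B N) := fun N => measurableSet_closedBall
  set k : ℕ → ℝ × (Fin n → ℝ) → ENNReal := fun N => (B N).indicator fun x => min (g x) N with hk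
  have hkm : ∀ N, Measurable (k N) := fun N => (hg.min measurable_const).indicator (hBm N)
  have hkg : ∀ N x, k N x ≤ g x := fun N x =>
    Set.indicator_apply_le' (fun _ => min_le_left _ _) (fun _ => zero_le)
  have hmono : Monotone k := by
    intro N M hNM x
    have hNM' : (N : ℝ) ≤ M := by exact_mod_cast hNM
    by_cases hx : x ∈ B N
    · have hx' : x ∈ B M := closedBall_subset_closedBall hNM' hx
      simp only [hk, Set.indicator_of_mem hx, Set.indicator_of_mem hx']
      exact min_le_min_left _ (by exact_mod_cast hNM)
    · simp only [hk, Set.indicator_of_notMem hx]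
      exact zero_le
  have hsup : ∀ x, g x = ⨆ N, k N x := by
    intro x
    refine le_antisymm (le_of_forall_lt fun c hc => ?_) (iSup_le fun N => hkg N x)
    obtain ⟨N₁, hN₁⟩ := exists_nat_ge ‖x‖
    obtain ⟨N₂, hN₂⟩ := ENNReal.exists_nat_gt hc.ne_top
    refine lt_of_lt_of_le ?_ (le_iSup _ (max N₁ N₂))
    have hx : x ∈ B (max N₁ N₂) := by
      simp only [hB, mem_closedBall, dist_zero_right]
      exact hN₁.trans (by exact_mod_cast le_max_left _ _)
    simp only [hk, Set.indicator_of_mem hx]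
    refine lt_min hc (hN₂.trans_le ?_)
    exact_mod_cast le_max_right _ _
  have hgint : ∫⁻ y, g y = ⨆ N, ∫⁻ y, k N y := by
    rw [← lintegral_iSup hkm hmono]
    exact lintegral_congr hsup
  rw [hgint, ENNReal.mul_iSup]
  refine iSup_le fun N => ?_
  have hkfin : ∫⁻ x, k N x ≠ ⊤ := by
    refine ne_top_of_le_ne_top (b := ∫⁻ x in B N, N) ?_ ?_
    · rw [setLIntegral_const]
      exact ENNReal.mul_ne_top (ENNReal.natCast_ne_top N) measure_closedBall_lt_top.ne
    · rw [← lintegral_indicator (hBm N)]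
      refine lintegral_mono fun x => ?_
      simp only [hk]
      exact Set.indicator_le_indicator (min_le_right _ _)
  have := isFiniteMeasure_withDensity hkfin
  have hsupp : ∀ᵐ x ∂(volume.withDensity (k N)), x ∈ B N := by
    rw [ae_iff]
    change (volume.withDensity (k N)) (B N)ᶜ = 0
    rw [withDensity_apply _ (hBm N).compl]
    refine (setLIntegral_congr_fun (hBm N).compl fun x hx => ?_).trans (lintegral_zero)
    simp only [hk]
    exact Set.indicator_of_notMem hx _
  have hbdd : ∀ L : ℝ × (Fin n → ℝ) → ℝ, Measurable L → (∀ x, |L x| ≤ ‖x‖) →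
      Integrable L (volume.withDensity (k N)) := by
    intro L hL hLx
    refine Integrable.of_bound hL.aestronglyMeasurable N ?_
    filter_upwards [hsupp] with x hx
    simp only [hB, mem_closedBall, dist_zero_right] at hx
    exact (hLx x).trans hx
  refine hP.prod_of_moments hf (hkm N) hffin hf1 hf2 hf1' hf2' hkfin
    (hbdd _ measurable_fst fun x => ?_) (fun i => hbdd _ (by fun_prop) fun x => ?_)
    (fun x y => (mul_le_mul_right (hkg N y) _).trans (H x y))
  · exact norm_fst_le x
  · exact (norm_le_pi_norm x.2 i).trans (norm_snd_le x)

/-- The functional Santaló inequality in every dimension. -/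
theorem functionalSantalo (n : ℕ) : FunctionalSantalo n := by
  induction n with
  | zero =>
    intro C f g hf hg _ _ _ H
    have hv : volume (Set.univ : Set (Fin 0 → ℝ)) = 1 := by
      rw [volume_pi, Measure.pi_univ]
      simp
    rw [lintegral_unique, lintegral_unique, hv]
    simpa only [mul_one, pow_zero, dotProduct, Finset.univ_eq_empty, Finset.sum_empty, neg_zero,
      Real.exp_zero, ENNReal.ofReal_one] using H _ _
  | succ n ih =>
    intro C f g hf hg hfin hint hbar H
    set e := MeasurableEquiv.piFinSuccAbove (fun _ : Fin (n + 1) => ℝ) 0 with he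
    have hep : MeasurePreserving e.symm :=
      (volume_preserving_piFinSuccAbove (fun _ : Fin (n + 1) => ℝ) 0).symm
    have h0 : ∀ x, e.symm x 0 = x.1 := fun x => by simp [he]
    have hs : ∀ x (i : Fin n), e.symm x i.succ = x.2 i := fun x i => by
      rw [he, MeasurableEquiv.piFinSuccAbove_symm_apply]
      simp [Fin.insertNthEquiv]
    have hdot : ∀ x y, e.symm x ⬝ᵥ e.symm y = x.1 * y.1 + x.2 ⬝ᵥ y.2 := fun x y => by
      simp only [dotProduct, Fin.sum_univ_succ, h0, hs]
    have hmap : volume.withDensity f = (volume.withDensity (f ∘ e.symm)).map e.symm := by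
      ext A hA
      rw [Measure.map_apply e.symm.measurable hA, withDensity_apply _ hA,
        withDensity_apply _ (e.symm.measurable hA)]
      exact (hep.setLIntegral_comp_preimage hA hf).symm
    have hfi : ∫⁻ x, f x = ∫⁻ x, (f ∘ e.symm) x := (hep.lintegral_comp hf).symm
    have hgi : ∫⁻ x, g x = ∫⁻ x, (g ∘ e.symm) x := (hep.lintegral_comp hg).symm
    simp only [hmap, e.symm.measurableEmbedding.integrable_map_iff] at hint
    simp only [hmap, e.symm.measurableEmbedding.integral_map] at hbar
    rw [hfi, hgi]
    refine ih.prod (hf.comp e.symm.measurable) (hg.comp e.symm.measurable) (hfi ▸ hfin)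
      ((hint 0).congr (.of_forall h0))
      (fun i => (hint i.succ).congr (.of_forall fun x => hs x i)) ?_ (fun i => ?_) (fun x y => ?_)
    · rw [← hbar 0]
      exact integral_congr_ae (.of_forall fun x => (h0 x).symm)
    · rw [← hbar i.succ]
      exact integral_congr_ae (.of_forall fun x => (hs x i).symm)
    · rw [← hdot]
      exact H _ _

/-! ### The Blaschke–Santaló inequality for bodies with centroid at the origin -/

/-- The functional Santaló inequality on `Space n`, with the Euclidean inner product. -/
lemma functionalSantalo_space {n : ℕ} {C : ENNReal} {f g : Space n → ENNReal}
    (hf : Measurable f) (hg : Measurable g) (hfin : ∫⁻ x, f x ≠ ⊤)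
    (hint : ∀ i, Integrable (fun x : Space n => x i) (volume.withDensity f))
    (hbar : ∀ i, ∫ x : Space n, x i ∂(volume.withDensity f) = 0)
    (H : ∀ x y, f x * g y ≤ C * ENNReal.ofReal (Real.exp (-⟪x, y⟫))) :
    (∫⁻ x, f x) * (∫⁻ y, g y) ≤ C * ENNReal.ofReal ((2 * Real.pi) ^ (n + 1)) := by
  set e := (MeasurableEquiv.toLp 2 (Fin (n + 1) → ℝ)) with he
  have hep : MeasurePreserving e :=
    (EuclideanSpace.volume_preserving_symm_measurableEquiv_toLp (Fin (n + 1))).symm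
  have hmap : volume.withDensity f = (volume.withDensity (f ∘ e)).map e := by
    ext A hA
    rw [Measure.map_apply e.measurable hA, withDensity_apply _ hA,
      withDensity_apply _ (e.measurable hA)]
    exact (hep.setLIntegral_comp_preimage hA hf).symm
  have hfi : ∫⁻ x, f x = ∫⁻ x, (f ∘ e) x := (hep.lintegral_comp hf).symm
  have hgi : ∫⁻ x, g x = ∫⁻ x, (g ∘ e) x := (hep.lintegral_comp hg).symm
  simp only [hmap, e.measurableEmbedding.integrable_map_iff] at hint
  simp only [hmap, e.measurableEmbedding.integral_map] at hbar
  rw [hfi, hgi]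
  refine functionalSantalo (n + 1) C _ _ (hf.comp e.measurable) (hg.comp e.measurable)
    (hfi ▸ hfin) hint hbar fun x y => (H _ _).trans_eq ?_
  congr 3
  simp [he, PiLp.inner_apply, dotProduct, mul_comm]

lemma lintegral_Ioi_mul_exp {a : ℝ} (ha : 0 ≤ a) :
    ∫⁻ r in Set.Ioi a, ENNReal.ofReal (r * Real.exp (-(r ^ 2 / 2))) =
      ENNReal.ofReal (Real.exp (-(a ^ 2 / 2))) := by
  have hd : ∀ x ∈ Set.Ici a, HasDerivAt (fun r : ℝ => -Real.exp (-(r ^ 2 / 2)))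
      (x * Real.exp (-(x ^ 2 / 2))) x := fun x _ => by
    have h : HasDerivAt (fun r : ℝ => -(r ^ 2 / 2)) (-x) x :=
      ((hasDerivAt_pow 2 x).div_const 2).neg.congr_deriv (by norm_num)
    exact h.exp.neg.congr_deriv (by ring)
  have hpos : ∀ x ∈ Set.Ioi a, 0 ≤ x * Real.exp (-(x ^ 2 / 2)) := fun x hx =>
    mul_nonneg (ha.trans (le_of_lt hx)) (Real.exp_pos _).le
  have hlim : Filter.Tendsto (fun r : ℝ => -Real.exp (-(r ^ 2 / 2))) Filter.atTop (nhds 0) := by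
    rw [← neg_zero]
    refine (Real.tendsto_exp_neg_atTop_nhds_zero.comp ?_).neg
    exact (Filter.tendsto_pow_atTop two_ne_zero).atTop_div_const two_pos
  have h := integral_Ioi_of_hasDerivAt_of_nonneg' hd hpos hlim
  rw [← ofReal_integral_eq_lintegral_ofReal (integrableOn_Ioi_deriv_of_nonneg' hd hpos hlim)
    (by filter_upwards [ae_restrict_mem measurableSet_Ioi] with x hx using hpos x hx), h]
  simp

/-- The measure on the half-line with density `r ^ (n + 2) * exp (-r² / 2)`. -/
noncomputable def radialMeasure (n : ℕ) : Measure ℝ :=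
  (volume.restrict (Set.Ioi 0)).withDensity
    fun r => ENNReal.ofReal (r ^ (n + 2) * Real.exp (-(r ^ 2 / 2)))

lemma integrable_pow_mul_exp (k : ℕ) :
    Integrable (fun r : ℝ => r ^ k * Real.exp (-(r ^ 2 / 2))) := by
  have h := integrable_rpow_mul_exp_neg_mul_sq (b := 1 / 2) (by norm_num) (s := k)
    (by have : (0 : ℝ) ≤ k := k.cast_nonneg
        linarith)
  refine h.congr (.of_forall fun r => ?_)
  simp only [Real.rpow_natCast]
  congr 2
  ring

instance (n : ℕ) : IsFiniteMeasure (radialMeasure n) :=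
  isFiniteMeasure_withDensity_ofReal (integrable_pow_mul_exp _).integrableOn.2

lemma integrable_id_radialMeasure (n : ℕ) : Integrable (fun r => r) (radialMeasure n) := by
  unfold radialMeasure
  rw [integrable_withDensity_iff (by fun_prop) (.of_forall fun _ => ENNReal.ofReal_lt_top)]
  refine (integrable_pow_mul_exp (n + 3)).integrableOn.congr ?_
  filter_upwards [ae_restrict_mem measurableSet_Ioi] with r hr
  have : (0 : ℝ) < r := hr
  rw [ENNReal.toReal_ofReal (by positivity)]
  ring

/-- A superposition of indicators of dilates of `K`; it is `exp (-‖x‖_K² / 2)` with the gauge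
`‖·‖_K` of `K` when `K` is convex and contains the origin. This form makes its barycenter visible
without any information on the position of the origin. -/
noncomputable def gaussianOf {n : ℕ} (K : Set (Space n)) (x : Space n) : ENNReal :=
  ∫⁻ r in Set.Ioi (0 : ℝ), ENNReal.ofReal (r * Real.exp (-(r ^ 2 / 2))) *
    K.indicator 1 (r⁻¹ • x)

lemma measurable_gaussianOf_integrand {n : ℕ} {K : Set (Space n)} (hK : MeasurableSet K) :
    Measurable fun p : Space n × ℝ => ENNReal.ofReal (p.2 * Real.exp (-(p.2 ^ 2 / 2))) *
      K.indicator (1 : Space n → ENNReal) (p.2⁻¹ • p.1) :=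
  (by fun_prop : Measurable fun p : Space n × ℝ =>
    ENNReal.ofReal (p.2 * Real.exp (-(p.2 ^ 2 / 2)))).mul
    ((measurable_one.indicator hK).comp (by fun_prop))

lemma measurable_gaussianOf {n : ℕ} {K : Set (Space n)} (hK : MeasurableSet K) :
    Measurable (gaussianOf K) :=
  Measurable.lintegral_prod_right' (measurable_gaussianOf_integrand hK)

lemma lintegral_comp_inv_smul {n : ℕ} {r : ℝ} (hr : 0 < r) {φ : Space n → ENNReal}
    (hφ : Measurable φ) :
    ∫⁻ x, φ x = ENNReal.ofReal (r ^ (n + 1)) * ∫⁻ x, φ (r • x) := by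
  have h := Measure.map_addHaar_smul (volume : Measure (Space n)) hr.ne'
  have h2 : ∫⁻ x, φ (r • x) = ∫⁻ x, φ x ∂((volume : Measure (Space n)).map (r • ·)) :=
    (lintegral_map hφ (measurable_const_smul r)).symm
  have h3 : Module.finrank ℝ (Space n) = n + 1 := by simp
  rw [h2, h, h3, lintegral_smul_measure, smul_eq_mul, ← mul_assoc,
    ← ENNReal.ofReal_mul (by positivity), abs_of_pos (by positivity),
    mul_inv_cancel₀ (by positivity)]
  simp

/-- The measure with density `gaussianOf K` is the law of `r • x` with `r` and `x` independent, so
its barycenter is a multiple of that of `K`. -/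
lemma withDensity_gaussianOf {n : ℕ} {K : Set (Space n)} (hK : MeasurableSet K) :
    volume.withDensity (gaussianOf K) =
      ((radialMeasure n).prod (volume.restrict K)).map fun p => p.1 • p.2 := by
  ext A hA
  have hsm : Measurable fun p : ℝ × Space n => p.1 • p.2 := by fun_prop
  have hA1 : Measurable (A.indicator (1 : Space n → ENNReal)) := measurable_one.indicator hA
  have hK1 : Measurable (K.indicator (1 : Space n → ENNReal)) := measurable_one.indicator hK
  rw [withDensity_apply _ hA, Measure.map_apply hsm hA, Measure.prod_apply (hsm hA),
    ← lintegral_indicator hA]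
  have h1 : ∀ x, A.indicator (gaussianOf K) x = ∫⁻ r in Set.Ioi (0 : ℝ),
      ENNReal.ofReal (r * Real.exp (-(r ^ 2 / 2))) *
        (K.indicator 1 (r⁻¹ • x) * A.indicator 1 x) := fun x => by
    by_cases hx : x ∈ A <;> simp [hx, gaussianOf]
  simp only [h1]
  rw [lintegral_lintegral_swap ?_]
  · unfold radialMeasure
    rw [lintegral_withDensity_eq_lintegral_mul _ (by fun_prop)
      (measurable_measure_prodMk_left (hsm hA))]
    refine setLIntegral_congr_fun measurableSet_Ioi fun r hr => ?_
    have hr : (0 : ℝ) < r := hr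
    have hm : Measurable fun x : Space n =>
        K.indicator (1 : Space n → ENNReal) (r⁻¹ • x) * A.indicator 1 x :=
      (hK1.comp (measurable_const_smul _)).mul hA1
    simp only [Pi.mul_apply]
    rw [lintegral_const_mul _ hm, lintegral_comp_inv_smul hr hm, ← mul_assoc,
      ← ENNReal.ofReal_mul (by positivity)]
    congr 1
    · congr 1
      ring
    · rw [Measure.restrict_apply (measurable_prodMk_left (hsm hA)), ← lintegral_indicator_one
        ((measurable_prodMk_left (hsm hA)).inter hK)]
      refine lintegral_congr fun x => ?_
      rw [inv_smul_smul₀ hr.ne']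
      by_cases hx : x ∈ K <;> by_cases hx' : r • x ∈ A <;> simp [hx, hx']
  · refine Measurable.aemeasurable ?_
    have := (measurable_gaussianOf_integrand hK).mul (hA1.comp measurable_fst)
    convert this using 1
    ext p
    simp only [Pi.mul_apply, Function.comp_apply, mul_assoc]
    rfl

lemma lintegral_gaussianOf {n : ℕ} {K : Set (Space n)} (hK : MeasurableSet K) :
    ∫⁻ x, gaussianOf K x = radialMeasure n Set.univ * volume K := by
  have h := congrArg (fun μ => μ Set.univ) (withDensity_gaussianOf hK)
  rw [Measure.map_apply (by fun_prop) MeasurableSet.univ, Set.preimage_univ, ← Set.univ_prod_univ,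
    Measure.prod_prod] at h
  simpa using h

lemma integrable_gaussianOf {n : ℕ} {K : Set (Space n)} (hK : IsCompact K) (i : Fin (n + 1)) :
    Integrable (fun x : Space n => x i) (volume.withDensity (gaussianOf K)) := by
  rw [withDensity_gaussianOf hK.measurableSet,
    integrable_map_measure (by fun_prop) (by fun_prop)]
  have : IsFiniteMeasure (volume.restrict K) := ⟨by simpa using hK.measure_lt_top⟩
  exact (integrable_id_radialMeasure n).mul_prod (g := fun x : Space n => x i)
    ((by fun_prop : Continuous fun x : Space n => x i).continuousOn.integrableOn_compact hK)

lemma integral_gaussianOf {n : ℕ} {K : Set (Space n)} (hK : IsCompact K) (i : Fin (n + 1))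
    (h0 : ∫ x in K, x i = 0) :
    ∫ x : Space n, x i ∂(volume.withDensity (gaussianOf K)) = 0 := by
  rw [withDensity_gaussianOf hK.measurableSet, integral_map (by fun_prop) (by fun_prop)]
  have : IsFiniteMeasure (volume.restrict K) := ⟨by simpa using hK.measure_lt_top⟩
  have h := integral_prod_mul (μ := radialMeasure n) (ν := volume.restrict K) (fun r : ℝ => r)
    (fun x : Space n => x i)
  rw [h0, mul_zero] at h
  exact h

/-- The duality hypothesis of the functional Santaló inequality: `⟪x, y⟫ ≤ a * h y` with `a` the
gauge of `x`, and `2 * a * h ≤ a ^ 2 + h ^ 2`. -/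
lemma gaussianOf_mul_le {n : ℕ} {K : Set (Space n)} {h : Space n → ℝ}
    (hh : ∀ x ∈ K, ∀ y, ⟪x, y⟫ ≤ h y) (x y : Space n) :
    gaussianOf K x * ENNReal.ofReal (Real.exp (-(h y ^ 2 / 2))) ≤
      ENNReal.ofReal (Real.exp (-⟪x, y⟫)) := by
  by_cases hr : ∃ r : ℝ, 0 < r ∧ r⁻¹ • x ∈ K
  swap
  · have : gaussianOf K x = 0 := by
      unfold gaussianOf
      refine (setLIntegral_congr_fun measurableSet_Ioi fun r hr' => ?_).trans lintegral_zero
      have : r⁻¹ • x ∉ K := fun h => hr ⟨r, hr', h⟩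
      simp [this]
    simp [this]
  obtain ⟨r, hr0, hrK⟩ := hr
  have hscale : ∀ r : ℝ, 0 < r → r⁻¹ • x ∈ K → ⟪x, y⟫ ≤ r * h y := fun r hr0 hrK => by
    have := hh _ hrK y
    rw [real_inner_smul_left, inv_mul_le_iff₀ hr0] at this
    exact this
  have hrepr : ∃ a : ℝ, 0 ≤ a ∧ ⟪x, y⟫ ≤ a * h y ∧ ∀ r : ℝ, 0 < r → r⁻¹ • x ∈ K → a ≤ r := by
    rcases le_or_gt ⟪x, y⟫ 0 with h0 | h0
    · exact ⟨0, le_rfl, by simpa using h0, fun r hr _ => hr.le⟩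
    · have hpos : 0 < h y := by
        have := hscale r hr0 hrK
        by_contra hn
        nlinarith
      exact ⟨⟪x, y⟫ / h y, by positivity, by field_simp; exact le_rfl,
        fun r hr hK => (div_le_iff₀ hpos).2 (hscale r hr hK)⟩
  obtain ⟨a, ha0, hay, har⟩ := hrepr
  have hle : gaussianOf K x ≤ ENNReal.ofReal (Real.exp (-(a ^ 2 / 2))) := by
    rw [← lintegral_Ioi_mul_exp ha0, setLIntegral_congr (Ioi_ae_eq_Ici (a := a))]
    unfold gaussianOf
    rw [← lintegral_indicator measurableSet_Ioi, ← lintegral_indicator measurableSet_Ici]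
    refine lintegral_mono fun r => ?_
    by_cases hr : r ∈ Set.Ioi (0 : ℝ)
    · rw [Set.indicator_of_mem hr]
      by_cases hK : r⁻¹ • x ∈ K
      · rw [Set.indicator_of_mem hK, Set.indicator_of_mem (show r ∈ Set.Ici a from har r hr hK)]
        simp
      · simp [hK]
    · rw [Set.indicator_of_notMem hr]
      exact zero_le
  refine (mul_le_mul_left hle _).trans ?_
  rw [← ENNReal.ofReal_mul (Real.exp_pos _).le, ← Real.exp_add]
  refine ENNReal.ofReal_le_ofReal (Real.exp_le_exp.2 ?_)
  nlinarith [sq_nonneg (a - h y)]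

lemma exp_le_gaussianOf_closedBall {n : ℕ} (x : Space n) :
    ENNReal.ofReal (Real.exp (-(‖x‖ ^ 2 / 2))) ≤ gaussianOf (closedBall 0 1) x := by
  rw [← lintegral_Ioi_mul_exp (norm_nonneg x)]
  unfold gaussianOf
  rw [← lintegral_indicator measurableSet_Ioi, ← lintegral_indicator measurableSet_Ioi]
  refine lintegral_mono fun r => ?_
  by_cases hr : r ∈ Set.Ioi ‖x‖
  · have hr' : ‖x‖ < r := hr
    have h0 : 0 < r := (norm_nonneg x).trans_lt hr'
    have hmem : r⁻¹ • x ∈ closedBall (0 : Space n) 1 := by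
      rw [mem_closedBall, dist_zero_right, norm_smul, norm_inv, Real.norm_of_nonneg h0.le,
        inv_mul_le_iff₀ h0, mul_one]
      exact hr'.le
    rw [Set.indicator_of_mem hr, Set.indicator_of_mem (show r ∈ Set.Ioi (0 : ℝ) from h0),
      Set.indicator_of_mem hmem]
    simp
  · rw [Set.indicator_of_notMem hr]
    exact zero_le

/-- Integration in polar coordinates. -/
lemma lintegral_polar {n : ℕ} {g : Space n → ENNReal} (hg : Measurable g) :
    ∫⁻ x, g x = ∫⁻ θ, (∫⁻ r in Set.Ioi (0 : ℝ), ENNReal.ofReal (r ^ n) * g (r • (θ : Space n)))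
      ∂((volume : Measure (Space n)).toSphere) := by
  have hp := (volume : Measure (Space n)).measurePreserving_homeomorphUnitSphereProd
  have h3 : Module.finrank ℝ (Space n) - 1 = n := by simp
  rw [h3] at hp
  have hm : Measurable fun q : Sph n × Set.Ioi (0 : ℝ) => g ((q.2 : ℝ) • (q.1 : Space n)) :=
    hg.comp (by fun_prop)
  have h1 : ∫⁻ x, g x = ∫⁻ x : ({0}ᶜ : Set (Space n)), g x
      ∂((volume : Measure (Space n)).comap (↑)) := by
    rw [lintegral_subtype_comap (measurableSet_singleton _).compl, restrict_compl_singleton]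
  have h2 : ∫⁻ x : ({0}ᶜ : Set (Space n)), g x ∂((volume : Measure (Space n)).comap (↑)) =
      ∫⁻ q, g ((q.2 : ℝ) • (q.1 : Space n))
        ∂((volume : Measure (Space n)).toSphere.prod (Measure.volumeIoiPow n)) := by
    rw [← hp.lintegral_comp hm]
    refine lintegral_congr fun x => ?_
    have hx : ‖(x : Space n)‖ ≠ 0 := norm_ne_zero_iff.2 x.2
    simp [smul_smul, hx]
  rw [h1, h2, lintegral_prod _ hm.aemeasurable]
  refine lintegral_congr fun θ => ?_
  unfold Measure.volumeIoiPow
  have hm2 : Measurable fun r : Set.Ioi (0 : ℝ) => g ((r : ℝ) • (θ : Space n)) :=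
    hg.comp (by fun_prop)
  rw [lintegral_withDensity_eq_lintegral_mul _ (by fun_prop) hm2]
  exact lintegral_subtype_comap measurableSet_Ioi
    (fun r : ℝ => ENNReal.ofReal (r ^ n) * g (r • (θ : Space n)))

lemma lintegral_pow_mul_exp_sq (n : ℕ) {h : ℝ} (hh : 0 < h) :
    ∫⁻ r in Set.Ioi (0 : ℝ), ENNReal.ofReal (r ^ n) * ENNReal.ofReal (Real.exp (-((r * h) ^ 2 / 2))) =
      ENNReal.ofReal h ^ (-((n : ℝ) + 1)) *
        ENNReal.ofReal (2 ^ (((n : ℝ) - 1) / 2) * Real.Gamma (((n : ℝ) + 1) / 2)) := by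
  have hn : (0 : ℝ) ≤ n := n.cast_nonneg
  have h1 := integral_rpow_mul_exp_neg_mul_rpow (p := 2) (q := n) (b := h ^ 2 / 2) two_pos
    (by linarith) (by positivity)
  have h2 : ∀ r : ℝ, r ^ (n : ℝ) * Real.exp (-(h ^ 2 / 2) * r ^ (2 : ℝ)) =
      r ^ n * Real.exp (-((r * h) ^ 2 / 2)) := fun r => by
    rw [Real.rpow_natCast, Real.rpow_two]
    congr 2
    ring
  simp only [h2] at h1
  have hG : 0 < Real.Gamma (((n : ℝ) + 1) / 2) := Real.Gamma_pos_of_pos (by positivity)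
  have h3 : (h ^ 2 / 2) ^ (-((n : ℝ) + 1) / 2) * (1 / 2) * Real.Gamma (((n : ℝ) + 1) / 2) =
      h ^ (-((n : ℝ) + 1)) * (2 ^ (((n : ℝ) - 1) / 2) * Real.Gamma (((n : ℝ) + 1) / 2)) := by
    rw [Real.div_rpow (by positivity) (by norm_num), ← Real.rpow_natCast, ← Real.rpow_mul hh.le,
      show ((n : ℝ) - 1) / 2 = -(-((n : ℝ) + 1) / 2) - 1 by ring, Real.rpow_sub two_pos,
      Real.rpow_neg two_pos.le, Real.rpow_one]
    rw [show ((2 : ℕ) : ℝ) * (-((n : ℝ) + 1) / 2) = -((n : ℝ) + 1) by push_cast; ring]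
    field_simp
  rw [h3] at h1
  rw [ENNReal.ofReal_rpow_of_pos hh, ← ENNReal.ofReal_mul (by positivity), ← h1,
    ofReal_integral_eq_lintegral_ofReal]
  · refine setLIntegral_congr_fun measurableSet_Ioi fun r hr => ?_
    have : (0 : ℝ) < r := hr
    exact (ENNReal.ofReal_mul (by positivity)).symm
  · by_contra hni
    rw [integral_undef hni] at h1
    have : 0 < h ^ (-((n : ℝ) + 1)) * (2 ^ (((n : ℝ) - 1) / 2) * Real.Gamma (((n : ℝ) + 1) / 2)) :=
      by positivity
    exact this.ne h1
  · filter_upwards [ae_restrict_mem measurableSet_Ioi] with r hr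
    have : (0 : ℝ) < r := hr
    positivity

lemma lintegral_exp_neg_sq_half (n : ℕ) :
    (∫⁻ x : Space n, ENNReal.ofReal (Real.exp (-(‖x‖ ^ 2 / 2)))) ^ 2 =
      ENNReal.ofReal ((2 * Real.pi) ^ (n + 1)) := by
  have h := GaussianFourier.integral_rexp_neg_mul_sq_norm (V := Space n) (b := 1 / 2) (by norm_num)
  have h2 : ∀ x : Space n, Real.exp (-(1 / 2) * ‖x‖ ^ 2) = Real.exp (-(‖x‖ ^ 2 / 2)) := fun x => by
    congr 1
    ring
  simp only [h2] at h
  have hpos : 0 < (Real.pi / (1 / 2)) ^ ((Module.finrank ℝ (Space n) : ℝ) / 2) := by positivity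
  rw [← ofReal_integral_eq_lintegral_ofReal _ (.of_forall fun x => (Real.exp_pos _).le), h,
    ← ENNReal.ofReal_pow hpos.le, ← Real.rpow_natCast, ← Real.rpow_mul (by positivity)]
  · congr 1
    rw [show Real.pi / (1 / 2) = 2 * Real.pi by ring, ← Real.rpow_natCast]
    congr 1
    simp
  · by_contra hni
    rw [integral_undef hni] at h
    exact hpos.ne h

/-- The Blaschke–Santaló inequality for a compact set `K` with the volume of the unit ball and
centroid at the origin, as a bound for the mean of the power `-(n + 1)` of a majorant `h` of its
support function. The Gaussian integrals of `K` and of `h` are compared with those of the ball. -/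
theorem lintegral_rpow_le_one {n : ℕ} {K : Set (Space n)} (hK : IsCompact K)
    (hvol : volume K = volume (closedBall (0 : Space n) 1)) (hbar : ∀ i, ∫ x in K, x i = 0)
    {h : Space n → ℝ} (hm : Measurable h) (hh : ∀ x ∈ K, ∀ y, ⟪x, y⟫ ≤ h y)
    (hhom : ∀ (r : ℝ) (x : Space n), 0 < r → h (r • x) = r * h x)
    (hpos : ∀ θ : Sph n, 0 < h θ) :
    ∫⁻ θ : Sph n, ENNReal.ofReal (h θ) ^ (-((n : ℝ) + 1)) ∂(sphProb n) ≤ 1 := by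
  have hKm := hK.measurableSet
  set S := (volume : Measure (Space n)).toSphere with hS
  set J := ENNReal.ofReal (2 ^ (((n : ℝ) - 1) / 2) * Real.Gamma (((n : ℝ) + 1) / 2)) with hJ
  have hG : 0 < Real.Gamma (((n : ℝ) + 1) / 2) := Real.Gamma_pos_of_pos (by positivity)
  have hJ0 : J ≠ 0 := by
    rw [hJ, ← pos_iff_ne_zero, ENNReal.ofReal_pos]
    positivity
  set Γ := ∫⁻ x : Space n, ENNReal.ofReal (Real.exp (-(‖x‖ ^ 2 / 2))) with hΓ
  have hΓ2 : Γ ^ 2 = ENNReal.ofReal ((2 * Real.pi) ^ (n + 1)) := lintegral_exp_neg_sq_half n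
  have hΓ0 : Γ ≠ 0 := by
    intro h0
    rw [h0] at hΓ2
    have : 0 < (2 * Real.pi) ^ (n + 1) := by positivity
    simp [this.not_ge] at hΓ2
  have hΓt : Γ ≠ ⊤ := by
    intro h0
    rw [h0] at hΓ2
    simp at hΓ2
  have hpolar : ∀ k : Space n → ℝ, Measurable k →
      (∀ (r : ℝ) (x : Space n), 0 < r → k (r • x) = r * k x) → (∀ θ : Sph n, 0 < k θ) →
      ∫⁻ x, ENNReal.ofReal (Real.exp (-(k x ^ 2 / 2))) =
        (∫⁻ θ : Sph n, ENNReal.ofReal (k θ) ^ (-((n : ℝ) + 1)) ∂S) * J := by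
    intro k hk hkhom hkpos
    rw [lintegral_polar (by fun_prop), ← lintegral_mul_const' _ _ ENNReal.ofReal_ne_top]
    refine lintegral_congr fun θ => ?_
    rw [← lintegral_pow_mul_exp_sq n (hkpos θ)]
    refine setLIntegral_congr_fun measurableSet_Ioi fun r hr => ?_
    simp only [hkhom r _ hr]
  have hball : Γ = S Set.univ * J := by
    rw [hΓ, hpolar (fun x => ‖x‖) measurable_norm (fun r x hr => by
      simp [norm_smul, abs_of_pos hr]) (fun θ => by simp)]
    simp
  have hmain := functionalSantalo_space (C := 1) (measurable_gaussianOf hKm)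
    (g := fun y => ENNReal.ofReal (Real.exp (-(h y ^ 2 / 2)))) (by fun_prop)
    (by
      rw [lintegral_gaussianOf hKm]
      exact ENNReal.mul_ne_top (measure_ne_top _ _) hK.measure_lt_top.ne)
    (integrable_gaussianOf hK) (fun i => integral_gaussianOf hK i (hbar i))
    (fun x y => by
      rw [one_mul]
      exact gaussianOf_mul_le hh x y)
  have hΓle : Γ ≤ ∫⁻ x, gaussianOf K x := by
    rw [lintegral_gaussianOf hKm, hvol, ← lintegral_gaussianOf measurableSet_closedBall]
    exact lintegral_mono exp_le_gaussianOf_closedBall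
  rw [one_mul, ← hΓ2, hpolar h hm hhom hpos] at hmain
  have h2 := (mul_le_mul_left hΓle _).trans hmain
  rw [sq] at h2
  have h3 := (ENNReal.mul_le_mul_iff_right hΓ0 hΓt).1 h2
  rw [hball] at h3
  have h4 := (ENNReal.mul_le_mul_iff_left hJ0 ENNReal.ofReal_ne_top).1 h3
  rw [sphProb, lintegral_smul_measure, smul_eq_mul]
  refine (mul_le_mul_right h4 _).trans ?_
  exact ENNReal.inv_mul_le_one _

/-! ### Support functions and the centroid -/

section SupportFunction

variable {n : ℕ} {K : Set (Space n)}

lemma inner_sub_le_supportFn (hK : IsCompact K) (z : Space n) (x : Sph n) {y : Space n}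
    (hy : y ∈ K) : ⟪y - z, (x : Space n)⟫ ≤ supportFn K z x :=
  le_csSup (hK.image (by fun_prop : Continuous fun y : Space n => ⟪y - z, (x : Space n)⟫)).bddAbove
    ⟨y, hy, rfl⟩

lemma supportFn_nonneg (hK : IsCompact K) {z : Space n} (hz : z ∈ K) (x : Sph n) :
    0 ≤ supportFn K z x := by
  simpa using inner_sub_le_supportFn hK z x hz

lemma continuous_sSup_inner (hK : IsCompact K) (z : Space n) :
    Continuous fun x : Space n => sSup ((fun y : Space n => ⟪y - z, x⟫) '' K) :=
  hK.continuous_sSup (f := fun x y => ⟪y - z, x⟫) (by fun_prop)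

lemma continuous_supportFn (hK : IsCompact K) (z : Space n) : Continuous (supportFn K z) :=
  (continuous_sSup_inner hK z).comp continuous_subtype_val

lemma exists_dist_eq_diam (hK : IsCompact K) (hne : K.Nonempty) :
    ∃ y₁ ∈ K, ∃ y₂ ∈ K, ‖y₁ - y₂‖ = diam K := by
  obtain ⟨⟨y₁, y₂⟩, ⟨h1, h2⟩, hmax⟩ := (hK.prod hK).exists_isMaxOn (hne.prod hne)
    (continuous_dist (α := Space n)).continuousOn
  refine ⟨y₁, h1, y₂, h2, ?_⟩
  rw [← dist_eq_norm]
  refine le_antisymm (dist_le_diam_of_mem hK.isBounded h1 h2)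
    (diam_le_of_forall_dist_le dist_nonneg fun a ha b hb => ?_)
  exact isMaxOn_iff.1 hmax (a, b) (Set.mk_mem_prod ha hb)

end SupportFunction

section Centroid

variable {n : ℕ} {Ω : ConvexBody (Space n)}

lemma volume_pos (hΩ : HasUnitBallVolume Ω) : 0 < volume (Ω : Set (Space n)) := by
  rw [hΩ]
  exact measure_closedBall_pos _ _ one_pos

lemma volume_ne_top (Ω : ConvexBody (Space n)) : volume (Ω : Set (Space n)) ≠ ⊤ :=
  Ω.isCompact.measure_lt_top.ne

lemma interior_nonempty (hΩ : HasUnitBallVolume Ω) : (interior (Ω : Set (Space n))).Nonempty := by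
  rw [Ω.convex.interior_nonempty_iff_affineSpan_eq_top]
  by_contra h
  have h1 := Measure.addHaar_affineSubspace volume _ h
  have h2 := measure_mono (μ := volume) (subset_affineSpan ℝ (Ω : Set (Space n)))
  exact ((volume_pos hΩ).trans_le (h2.trans_eq h1)).ne rfl

lemma integrableOn_id (Ω : ConvexBody (Space n)) :
    IntegrableOn (fun y : Space n => y) (Ω : Set (Space n)) :=
  continuousOn_id.integrableOn_compact Ω.isCompact

lemma centroid_mem (hΩ : HasUnitBallVolume Ω) :
    centroid (Ω : Set (Space n)) ∈ (Ω : Set (Space n)) :=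
  Ω.convex.set_average_mem Ω.isClosed (volume_pos hΩ).ne' (volume_ne_top Ω)
    (ae_restrict_mem Ω.isClosed.measurableSet) (integrableOn_id Ω)

lemma volumeReal_smul_centroid (hΩ : HasUnitBallVolume Ω) :
    volume.real (Ω : Set (Space n)) • centroid (Ω : Set (Space n)) =
      ∫ y in (Ω : Set (Space n)), y := by
  have h : volume.real (Ω : Set (Space n)) ≠ 0 :=
    (ENNReal.toReal_pos (volume_pos hΩ).ne' (volume_ne_top Ω)).ne'
  rw [centroid, setAverage_eq, smul_inv_smul₀ h]

lemma lintegral_Ioc_one_sub_div_pow (d : ℕ) {G : ℝ} (hG : 0 < G) :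
    ∫⁻ t in Set.Ioc 0 G, ENNReal.ofReal ((1 - t / G) ^ d) = ENNReal.ofReal (G / (d + 1)) := by
  have h := intervalIntegral.integral_comp_sub_div (a := 0) (b := G) (fun x : ℝ => x ^ d) hG.ne' 1
  rw [div_self hG.ne', zero_div, sub_self, sub_zero, integral_pow] at h
  rw [← ofReal_integral_eq_lintegral_ofReal, ← intervalIntegral.integral_of_le hG.le, h]
  · congr 1
    simp
    ring
  · exact ((by fun_prop : Continuous fun t : ℝ => (1 - t / G) ^ d).integrableOn_Icc).mono_set
      Set.Ioc_subset_Icc_self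
  · filter_upwards [ae_restrict_mem measurableSet_Ioc] with t ht
    exact pow_nonneg (sub_nonneg.2 ((div_le_one hG).2 ht.2)) _

/-- The width of a convex body in a direction is at most `n + 2` times its support function with
respect to the centroid. The homotheties centered at a point where the linear functional is
minimal bound its distribution function. -/
lemma inner_sub_le_mul_supportFn_centroid (hΩ : HasUnitBallVolume Ω) (x : Sph n)
    {y₁ y₂ : Space n} (h₁ : y₁ ∈ (Ω : Set (Space n))) (h₂ : y₂ ∈ (Ω : Set (Space n))) :
    ⟪y₁ - y₂, (x : Space n)⟫ ≤
      ((n : ℝ) + 2) * supportFn (Ω : Set (Space n)) (centroid (Ω : Set (Space n))) x := by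
  set c := centroid (Ω : Set (Space n)) with hc
  set u := supportFn (Ω : Set (Space n)) c x with hu
  have hu0 : 0 ≤ u := supportFn_nonneg Ω.isCompact (centroid_mem hΩ) x
  have hn : (0 : ℝ) ≤ n := n.cast_nonneg
  set M := u + ⟪c, (x : Space n)⟫ with hM
  set g : Space n → ℝ := fun y => M - ⟪y, (x : Space n)⟫ with hg
  have hgc : Continuous g := by fun_prop
  have hg0 : ∀ y ∈ (Ω : Set (Space n)), 0 ≤ g y := fun y hy => by
    have := inner_sub_le_supportFn Ω.isCompact c x hy
    rw [inner_sub_left] at this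
    simp only [hg, hM]
    linarith
  set G := g y₂ with hG
  have hle : ⟪y₁ - y₂, (x : Space n)⟫ ≤ G := by
    have := hg0 _ h₁
    rw [inner_sub_left]
    simp only [hg] at this
    simp only [hG, hg]
    linarith
  refine hle.trans ?_
  rcases (show 0 ≤ G from hg0 _ h₂).eq_or_lt with h0 | hGpos
  · rw [← h0]
    positivity
  have hΩm := Ω.isClosed.measurableSet
  set V := volume (Ω : Set (Space n)) with hV
  have hgint : IntegrableOn g (Ω : Set (Space n)) :=
    hgc.continuousOn.integrableOn_compact Ω.isCompact
  have hVr : 0 < V.toReal := ENNReal.toReal_pos (volume_pos hΩ).ne' (volume_ne_top Ω)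
  have hgval : ∫ y in (Ω : Set (Space n)), g y = V.toReal * u := by
    have h1 : ∫ y in (Ω : Set (Space n)), ⟪y, (x : Space n)⟫ = V.toReal * ⟪c, (x : Space n)⟫ := by
      have h2 := integral_inner (𝕜 := ℝ) (integrableOn_id Ω) (x : Space n)
      rw [← volumeReal_smul_centroid hΩ, real_inner_smul_right, real_inner_comm] at h2
      rw [← measureReal_def, ← hc.symm, ← h2]
      exact integral_congr_ae (.of_forall fun y => real_inner_comm _ _)
    have h3 : IntegrableOn (fun y : Space n => ⟪y, (x : Space n)⟫) (Ω : Set (Space n)) :=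
      (by fun_prop : Continuous fun y : Space n => ⟪y, (x : Space n)⟫).continuousOn.integrableOn_compact
        Ω.isCompact
    have h4 : IntegrableOn (fun _ : Space n => M) (Ω : Set (Space n)) :=
      continuousOn_const.integrableOn_compact Ω.isCompact
    simp only [hg]
    rw [integral_sub h4 h3, h1, setIntegral_const, measureReal_def, smul_eq_mul, hM]
    ring
  have hlayer : ENNReal.ofReal (G / ((n : ℝ) + 2)) * V ≤ ENNReal.ofReal (V.toReal * u) := by
    rw [← hgval, ofReal_integral_eq_lintegral_ofReal hgint
      (by filter_upwards [ae_restrict_mem hΩm] with y hy using hg0 y hy),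
      lintegral_eq_lintegral_meas_le _
      (by filter_upwards [ae_restrict_mem hΩm] with y hy using hg0 y hy) hgc.aemeasurable]
    have h1 := lintegral_Ioc_one_sub_div_pow (n + 1) hGpos
    rw [show ((n + 1 : ℕ) : ℝ) + 1 = (n : ℝ) + 2 by push_cast; ring] at h1
    rw [← h1, ← lintegral_mul_const' _ _ (volume_ne_top Ω)]
    refine (setLIntegral_mono' measurableSet_Ioc fun t ht => ?_).trans
      (lintegral_mono_set Set.Ioc_subset_Ioi_self)
    have hs0 : 0 ≤ 1 - t / G := sub_nonneg.2 ((div_le_one hGpos).2 ht.2)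
    have himg := Measure.addHaar_image_homothety volume y₂ (1 - t / G) (Ω : Set (Space n))
    rw [show Module.finrank ℝ (Space n) = n + 1 by simp, abs_of_nonneg (by positivity)] at himg
    rw [← himg, Measure.restrict_apply (measurableSet_le measurable_const hgc.measurable)]
    refine measure_mono ?_
    rintro _ ⟨y, hy, rfl⟩
    have hst : 1 - t / G ≤ 1 := by
      have : 0 ≤ t / G := by
        have := ht.1.le
        positivity
      linarith
    refine ⟨?_, ?_⟩
    · have := hg0 y hy
      simp only [Set.mem_ofPred_eq, AffineMap.homothety_apply, vsub_eq_sub, vadd_eq_add, hg,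
        inner_add_left, real_inner_smul_left, inner_sub_left] at this ⊢
      have hGe : G = M - ⟪y₂, (x : Space n)⟫ := rfl
      have ht' : (t / G) * G = t := div_mul_cancel₀ _ hGpos.ne'
      have h6 : (1 - t / G) * (M - ⟪y, (x : Space n)⟫) ≥ 0 := mul_nonneg hs0 this
      rw [hGe] at ht' h6
      rw [hGe]
      linarith
    · rw [AffineMap.homothety_eq_lineMap]
      exact Ω.convex.lineMap_mem h₂ hy ⟨hs0, hst⟩
  have hlayer' : G / ((n : ℝ) + 2) * V.toReal ≤ u * V.toReal := by
    rw [← ENNReal.ofReal_le_ofReal_iff (by positivity), ENNReal.ofReal_mul (by positivity),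
      ENNReal.ofReal_toReal (volume_ne_top Ω), mul_comm u]
    exact hlayer
  have h7 : G / ((n : ℝ) + 2) ≤ u := le_of_mul_le_mul_right hlayer' hVr
  rwa [div_le_iff₀' (by positivity)] at h7

lemma supportFn_centroid_pos (hΩ : HasUnitBallVolume Ω) (x : Sph n) :
    0 < supportFn (Ω : Set (Space n)) (centroid (Ω : Set (Space n))) x := by
  obtain ⟨y, hy⟩ := interior_nonempty hΩ
  obtain ⟨ε, hε, hball⟩ := Metric.isOpen_iff.1 isOpen_interior y hy
  have hx : ‖(x : Space n)‖ = 1 := by simp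
  have h1 : y + (ε / 2) • (x : Space n) ∈ (Ω : Set (Space n)) := by
    refine interior_subset (hball ?_)
    rw [mem_ball, dist_eq_norm, add_sub_cancel_left, norm_smul, hx, mul_one,
      Real.norm_of_nonneg (by positivity)]
    linarith
  have h2 := inner_sub_le_mul_supportFn_centroid hΩ x h1 (interior_subset hy)
  rw [add_sub_cancel_left, real_inner_smul_left, real_inner_self_eq_norm_sq, hx] at h2
  have : (0 : ℝ) ≤ n := n.cast_nonneg
  by_contra hn
  nlinarith

/-- The Blaschke–Santaló inequality with respect to the centroid. -/
theorem lintegral_supportFn_rpow_le_one (hΩ : HasUnitBallVolume Ω) :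
    ∫⁻ x, ENNReal.ofReal (supportFn (Ω : Set (Space n)) (centroid (Ω : Set (Space n))) x) ^
      (-((n : ℝ) + 1)) ∂(sphProb n) ≤ 1 := by
  set c := centroid (Ω : Set (Space n)) with hc
  have hp : MeasurePreserving (fun y : Space n => y + c) volume volume :=
    measurePreserving_add_right volume c
  have he : MeasurableEmbedding fun y : Space n => y + c :=
    (Homeomorph.addRight c).measurableEmbedding
  refine lintegral_rpow_le_one (K := (fun y => y + c) ⁻¹' (Ω : Set (Space n)))
    (h := fun x : Space n => sSup ((fun y : Space n => ⟪y - c, x⟫) '' (Ω : Set (Space n))))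
    ((Homeomorph.addRight c).isCompact_preimage.2 Ω.isCompact) ?_ (fun i => ?_)
    (continuous_sSup_inner Ω.isCompact c).measurable (fun x hx y => ?_) (fun r x hr => ?_)
    (supportFn_centroid_pos hΩ)
  · rw [hp.measure_preimage_emb he]
    exact hΩ
  · have h1 := hp.setIntegral_preimage_emb he (fun y : Space n => (y - c) i) (Ω : Set (Space n))
    simp only [add_sub_cancel_right] at h1
    rw [h1]
    have h2 : IntegrableOn (fun y : Space n => y - c) (Ω : Set (Space n)) :=
      (by fun_prop : Continuous fun y : Space n => y - c).continuousOn.integrableOn_compact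
        Ω.isCompact
    have h3 : ∫ y in (Ω : Set (Space n)), (y - c) = 0 := by
      rw [integral_sub (integrableOn_id Ω) (continuousOn_const.integrableOn_compact Ω.isCompact),
        setIntegral_const, ← volumeReal_smul_centroid hΩ, sub_self]
    have h4 := (EuclideanSpace.proj (𝕜 := ℝ) i).integral_comp_comm h2
    rw [h3] at h4
    simpa using h4
  · refine le_csSup (Ω.isCompact.image
      (by fun_prop : Continuous fun z : Space n => ⟪z - c, y⟫)).bddAbove ⟨x + c, hx, ?_⟩
    simp
  · rw [← smul_eq_mul, ← Real.sSup_smul_of_nonneg hr.le]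
    congr 1
    ext t
    simp [Set.mem_smul_set, real_inner_smul_right]

end Centroid

/-! ### An ellipsoid from a simplex of maximal volume -/

section Ellipsoid

variable {n : ℕ}

/-- The matrix whose columns are the vectors `v k`, preceded by an entry `1`. -/
def homogMatrix (v : Fin (n + 2) → Space n) : Matrix (Fin (n + 2)) (Fin (n + 2)) ℝ :=
  Matrix.of fun i k => (Fin.cons 1 (fun j => v k j) : Fin (n + 2) → ℝ) i

lemma continuous_det_homogMatrix :
    Continuous fun v : Fin (n + 2) → Space n => (homogMatrix v).det := by
  refine Continuous.matrix_det (continuous_matrix fun i k => ?_)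
  refine Fin.cases ?_ (fun j => ?_) i
  · simpa [homogMatrix] using continuous_const
  · simp only [homogMatrix, Matrix.of_apply, Fin.cons_succ]
    fun_prop

lemma exists_det_homogMatrix_ne_zero {S : Set (Space n)} (hS : (interior S).Nonempty) :
    ∃ v : Fin (n + 2) → Space n, (∀ k, v k ∈ S) ∧ (homogMatrix v).det ≠ 0 := by
  obtain ⟨y, hy⟩ := hS
  obtain ⟨ε, hε, hball⟩ := Metric.isOpen_iff.1 isOpen_interior y hy
  refine ⟨Fin.cons y fun j => y + EuclideanSpace.single j (ε / 2), fun k => ?_, fun h0 => ?_⟩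
  · refine Fin.cases ?_ (fun j => ?_) k
    · simpa using interior_subset hy
    · rw [Fin.cons_succ]
      refine interior_subset (hball ?_)
      rw [mem_ball, dist_eq_norm, add_sub_cancel_left, PiLp.norm_single,
        Real.norm_of_nonneg (by positivity)]
      linarith
  · obtain ⟨μ, hμ0, hμ⟩ := Matrix.exists_mulVec_eq_zero_iff.2 h0
    have h1 : μ 0 + ∑ k : Fin (n + 1), μ k.succ = 0 := by
      have := congrFun hμ 0
      simpa [homogMatrix, Matrix.mulVec, dotProduct, Fin.sum_univ_succ] using this
    have h2 : ∀ j : Fin (n + 1), μ j.succ = 0 := by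
      intro j
      have := congrFun hμ j.succ
      rw [Matrix.mulVec, dotProduct, Fin.sum_univ_succ] at this
      simp only [homogMatrix, Matrix.of_apply, Fin.cons_succ, Fin.cons_zero, Pi.zero_apply,
        PiLp.add_apply, add_mul, Finset.sum_add_distrib, ← Finset.mul_sum,
        PiLp.single_apply] at this
      rw [← add_assoc, ← mul_add, h1, mul_zero, zero_add] at this
      simp only [ite_mul, zero_mul, Finset.sum_ite_eq, Finset.mem_univ, if_true] at this
      rcases mul_eq_zero.1 this with h | h
      · linarith
      · exact h
    refine hμ0 (funext fun k => ?_)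
    refine Fin.cases ?_ (fun j => h2 j) k
    simpa [h2] using h1

/-- A compact set with interior points contains the vertices of a simplex (one of maximal volume)
with respect to which all its points have barycentric coordinates in `[-1, 1]`, by Cramer's
rule. -/
lemma exists_simplex {S : Set (Space n)} (hS : IsCompact S) (hint : (interior S).Nonempty) :
    ∃ v : Fin (n + 2) → Space n, (∀ k, v k ∈ S) ∧
      ∀ y ∈ S, ∃ l : Fin (n + 2) → ℝ, (∀ k, |l k| ≤ 1) ∧ ∑ k, l k = 1 ∧ ∑ k, l k • v k = y := by
  obtain ⟨v₀, hv₀, hdet₀⟩ := exists_det_homogMatrix_ne_zero hint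
  obtain ⟨v, hv, hmax⟩ := (isCompact_univ_pi fun _ : Fin (n + 2) => hS).exists_isMaxOn
    ⟨v₀, fun k _ => hv₀ k⟩ (continuous_det_homogMatrix.abs).continuousOn
  rw [isMaxOn_iff] at hmax
  have hdet : 0 < |(homogMatrix v).det| :=
    (abs_pos.2 hdet₀).trans_le (hmax v₀ fun k _ => hv₀ k)
  have hdet0 : (homogMatrix v).det ≠ 0 := abs_pos.1 hdet
  refine ⟨v, fun k => hv k (Set.mem_univ k), fun y hy => ?_⟩
  set w : Fin (n + 2) → ℝ := Fin.cons 1 fun j => y j with hw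
  have hupd : ∀ k, (homogMatrix v).updateCol k w = homogMatrix (Function.update v k y) := by
    intro k
    ext i j
    by_cases hjk : j = k
    · subst hjk
      simp [homogMatrix, hw]
    · simp [homogMatrix, hjk]
  have hmul := Matrix.mulVec_cramer (homogMatrix v) w
  have hsum : ∀ i, ∑ k, homogMatrix v i k * ((homogMatrix v).cramer w k / (homogMatrix v).det) =
      w i := by
    intro i
    have h := congrFun hmul i
    simp only [Matrix.mulVec, dotProduct, Pi.smul_apply, smul_eq_mul] at h
    rw [← mul_right_inj' hdet0, ← h, Finset.mul_sum]
    refine Finset.sum_congr rfl fun k _ => ?_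
    field_simp
  refine ⟨fun k => (homogMatrix v).cramer w k / (homogMatrix v).det, fun k => ?_, ?_, ?_⟩
  · rw [abs_div, div_le_one hdet, Matrix.cramer_apply, hupd]
    refine hmax _ fun j _ => ?_
    by_cases hjk : j = k
    · subst hjk
      simpa using hy
    · simpa [hjk] using hv j (Set.mem_univ j)
  · simpa [homogMatrix, hw] using hsum 0
  · ext j
    have := hsum j.succ
    simp only [homogMatrix, hw, Matrix.of_apply, Fin.cons_succ] at this
    simp only [WithLp.ofLp_sum, Finset.sum_apply, PiLp.smul_apply, smul_eq_mul]
    rw [← this]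
    exact Finset.sum_congr rfl fun k _ => mul_comm _ _

/-- Diagonalization of a sum of squares of linear functionals. -/
lemma exists_orthonormalBasis_sum_inner_sq {m : ℕ} (a : Fin m → Space n) :
    ∃ (b : OrthonormalBasis (Fin (n + 1)) ℝ (Space n)) (q : Fin (n + 1) → ℝ), Antitone q ∧
      ∀ x, ∑ k, ⟪a k, x⟫ ^ 2 = ∑ i, q i * ⟪b i, x⟫ ^ 2 := by
  set T : Space n →ₗ[ℝ] Space n :=
    ∑ k, (innerₛₗ ℝ (a k)).smulRight (a k) with hT
  have hTx : ∀ x, T x = ∑ k, ⟪a k, x⟫ • a k := fun x => by simp [hT]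
  have hsymm : T.IsSymmetric := fun x y => by
    rw [hTx, hTx, sum_inner, inner_sum]
    refine Finset.sum_congr rfl fun k _ => ?_
    rw [real_inner_smul_left, real_inner_smul_right, real_inner_comm x (a k)]
    ring
  have hfin : Module.finrank ℝ (Space n) = n + 1 := by simp
  refine ⟨hsymm.eigenvectorBasis hfin, hsymm.eigenvalues hfin,
    hsymm.eigenvalues_antitone hfin, fun x => ?_⟩
  have h1 : ⟪T x, x⟫ = ∑ k, ⟪a k, x⟫ ^ 2 := by
    rw [hTx, sum_inner]
    refine Finset.sum_congr rfl fun k _ => ?_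
    rw [real_inner_smul_left, sq]
  rw [← h1, ← (hsymm.eigenvectorBasis hfin).sum_inner_mul_inner]
  refine Finset.sum_congr rfl fun i _ => ?_
  rw [hsymm, hsymm.apply_eigenvectorBasis, real_inner_smul_right,
    real_inner_comm (hsymm.eigenvectorBasis hfin i) x]
  simp only [RCLike.ofReal_real_eq_id, id]
  ring

/-- The volume of a subset of the ellipsoid with semi-axes `s i • b i`. -/
lemma volume_le_of_sum_sq_le_one (b : OrthonormalBasis (Fin (n + 1)) ℝ (Space n))
    {s : Fin (n + 1) → ℝ} (hs : ∀ i, 0 < s i) {S : Set (Space n)}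
    (hS : ∀ y ∈ S, ∑ i, (⟪b i, y⟫ / s i) ^ 2 ≤ 1) :
    volume S ≤ ENNReal.ofReal (∏ i, s i) * volume (closedBall (0 : Space n) 1) := by
  set Φ : Space n →ₗ[ℝ] Space n := Matrix.toLin b.toBasis b.toBasis (Matrix.diagonal s) with hΦ
  have hdet : LinearMap.det Φ = ∏ i, s i := by
    rw [hΦ, LinearMap.det_toLin, Matrix.det_diagonal]
  have hΦb : ∀ i, Φ (b i) = s i • b i := fun i => by
    have := Matrix.toLin_self b.toBasis b.toBasis (Matrix.diagonal s) i
    simpa [Matrix.diagonal_apply, ite_smul] using this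
  have h := Measure.addHaar_image_linearMap volume Φ (closedBall (0 : Space n) 1)
  rw [hdet, abs_of_pos (Finset.prod_pos fun i _ => hs i)] at h
  rw [← h]
  refine measure_mono fun y hy => ⟨∑ i, (⟪b i, y⟫ / s i) • b i, ?_, ?_⟩
  · rw [mem_closedBall, dist_zero_right, ← sq_le_one_iff₀ (norm_nonneg _), ← b.sum_sq_inner_right]
    refine (Finset.sum_congr rfl fun i _ => ?_).trans_le (hS y hy)
    rw [b.orthonormal.inner_right_fintype]
  · rw [map_sum]
    simp only [map_smul, hΦb, smul_smul]
    conv_rhs => rw [← b.sum_repr' y]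
    refine Finset.sum_congr rfl fun i _ => ?_
    rw [div_mul_cancel₀ _ (hs i).ne']

/-- Position of a convex body `Ω` relative to an ellipsoid with semi-axes `r i • b i`: some
translate of the ellipsoid by a point of `Ω` lies in `Ω`, and the dilate by the factor
`(n + 1) * (n + 2)` contains `Ω`. The second fact is recorded through its consequences for diameter
and volume. -/
lemma exists_ellipsoid {Ω : ConvexBody (Space n)} (hΩ : HasUnitBallVolume Ω) :
    ∃ z ∈ (Ω : Set (Space n)), ∃ (b : OrthonormalBasis (Fin (n + 1)) ℝ (Space n))
      (r : Fin (n + 1) → ℝ), Antitone r ∧ (∀ i, 0 < r i) ∧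
      (∀ x : Sph n, ∑ i, r i ^ 2 * ⟪b i, (x : Space n)⟫ ^ 2 ≤
        supportFn (Ω : Set (Space n)) z x ^ 2) ∧
      diam (Ω : Set (Space n)) ≤ 2 * (((n : ℝ) + 1) * ((n : ℝ) + 2)) * r 0 ∧
      1 ≤ (((n : ℝ) + 1) * ((n : ℝ) + 2)) ^ (n + 1) * ∏ i, r i := by
  obtain ⟨v, hv, hbary⟩ := exists_simplex Ω.isCompact (interior_nonempty hΩ)
  have hn : (0 : ℝ) ≤ n := n.cast_nonneg
  have hcard : (Fintype.card (Fin (n + 2)) : ℝ) = (n : ℝ) + 2 := by simp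
  set z : Space n := ∑ k, ((n : ℝ) + 2)⁻¹ • v k with hz
  have hzmem : z ∈ (Ω : Set (Space n)) := by
    refine Ω.convex.sum_mem (fun _ _ => by positivity) ?_ fun k _ => hv k
    rw [Finset.sum_const, Finset.card_univ, nsmul_eq_mul, hcard, mul_inv_cancel₀ (by positivity)]
  set a : Fin (n + 2) → Space n := fun k => v k - z with ha
  have hasum : ∑ k, a k = 0 := by
    simp only [ha]
    rw [Finset.sum_sub_distrib, Finset.sum_const, Finset.card_univ, hz, ← Finset.smul_sum,
      ← Nat.cast_smul_eq_nsmul ℝ, hcard, smul_smul, mul_inv_cancel₀ (by positivity), one_smul,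
      sub_self]
  obtain ⟨b, q, hqanti, hq⟩ := exists_orthonormalBasis_sum_inner_sq a
  -- the quadratic form bounds the body from outside
  have hout : ∀ y ∈ (Ω : Set (Space n)), ∀ x, ⟪y - z, x⟫ ^ 2 ≤
      ((n : ℝ) + 2) * ∑ i, q i * ⟪b i, x⟫ ^ 2 := by
    intro y hy x
    obtain ⟨l, hl1, hls, hly⟩ := hbary y hy
    have h1 : y - z = ∑ k, l k • a k := by
      simp only [ha, smul_sub, Finset.sum_sub_distrib, hly, ← Finset.sum_smul, hls, one_smul]
    rw [h1, sum_inner, ← hq]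
    simp only [real_inner_smul_left]
    refine (Finset.sum_mul_sq_le_sq_mul_sq _ _ _).trans ?_
    refine mul_le_mul_of_nonneg_right ?_ (Finset.sum_nonneg fun k _ => sq_nonneg _)
    calc ∑ k, l k ^ 2 ≤ ∑ _k : Fin (n + 2), (1 : ℝ) :=
          Finset.sum_le_sum fun k _ => (sq_le_one_iff_abs_le_one _).2 (hl1 k)
      _ = (n : ℝ) + 2 := by simp
  have hqval : ∀ i, ∑ j, q j * ⟪b j, b i⟫ ^ 2 = q i := fun i => by
    simp [orthonormal_iff_ite.1 b.orthonormal]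
  have hqpos : ∀ i, 0 < q i := by
    intro i
    have h0 : 0 ≤ q i := by
      rw [← hqval i, ← hq]
      exact Finset.sum_nonneg fun k _ => sq_nonneg _
    refine h0.lt_of_ne' fun h => ?_
    have h1 : ∀ y ∈ (Ω : Set (Space n)), ⟪y - z, b i⟫ = 0 := fun y hy => by
      have := hout y hy (b i)
      rw [hqval, h, mul_zero] at this
      exact pow_eq_zero_iff two_ne_zero |>.1 (le_antisymm this (sq_nonneg _))
    obtain ⟨y, hy⟩ := interior_nonempty hΩ
    obtain ⟨ε, hε, hball⟩ := Metric.isOpen_iff.1 isOpen_interior y hy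
    have h2 : y + (ε / 2) • b i ∈ (Ω : Set (Space n)) := by
      refine interior_subset (hball ?_)
      rw [mem_ball, dist_eq_norm, add_sub_cancel_left, norm_smul, b.norm_eq_one, mul_one,
        Real.norm_of_nonneg (by positivity)]
      linarith
    have h3 := h1 _ h2
    have h4 := h1 _ (interior_subset hy)
    rw [add_sub_right_comm, inner_add_left, h4, real_inner_smul_left, real_inner_self_eq_norm_sq,
      b.norm_eq_one] at h3
    linarith
  set κ := ((n : ℝ) + 1) * Real.sqrt ((n : ℝ) + 2) with hκ
  have hκ0 : 0 < κ := by positivity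
  have hsq : Real.sqrt ((n : ℝ) + 2) ^ 2 = (n : ℝ) + 2 := Real.sq_sqrt (by positivity)
  have hκ2 : κ ^ 2 = ((n : ℝ) + 1) ^ 2 * ((n : ℝ) + 2) := by rw [hκ, mul_pow, hsq]
  have hκC : κ * Real.sqrt ((n : ℝ) + 2) = ((n : ℝ) + 1) * ((n : ℝ) + 2) := by
    rw [hκ, mul_assoc, ← sq, hsq]
  have hr2 : ∀ i, (Real.sqrt (q i) / κ) ^ 2 = q i / κ ^ 2 := fun i => by
    rw [div_pow, Real.sq_sqrt (hqpos i).le]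
  refine ⟨z, hzmem, b, fun i => Real.sqrt (q i) / κ, fun i j hij => ?_, fun i => ?_, fun x => ?_,
    ?_, ?_⟩
  · exact div_le_div_of_nonneg_right (Real.sqrt_le_sqrt (hqanti hij)) hκ0.le
  · exact div_pos (Real.sqrt_pos.2 (hqpos i)) hκ0
  · set u := supportFn (Ω : Set (Space n)) z x with hu
    have hu0 : 0 ≤ u := supportFn_nonneg Ω.isCompact hzmem x
    have hle : ∀ k, ⟪a k, (x : Space n)⟫ ≤ u := fun k =>
      inner_sub_le_supportFn Ω.isCompact z x (hv k)
    have hxsum : ∑ k, ⟪a k, (x : Space n)⟫ = 0 := by rw [← sum_inner, hasum, inner_zero_left]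
    have habs : ∀ k, ⟪a k, (x : Space n)⟫ ^ 2 ≤ (((n : ℝ) + 1) * u) ^ 2 := by
      intro k
      rw [sq_le_sq, abs_of_nonneg (by positivity : 0 ≤ ((n : ℝ) + 1) * u), abs_le]
      constructor
      · have h1 := Finset.add_sum_erase Finset.univ (fun k => ⟪a k, (x : Space n)⟫)
          (Finset.mem_univ k)
        have h2 : ∑ j ∈ Finset.univ.erase k, ⟪a j, (x : Space n)⟫ ≤ ((n : ℝ) + 1) * u := by
          refine (Finset.sum_le_card_nsmul _ _ u fun j _ => hle j).trans_eq ?_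
          rw [Finset.card_erase_of_mem (Finset.mem_univ k), nsmul_eq_mul]
          simp
        linarith
      · have := hle k
        nlinarith
    simp only [hr2]
    have h3 : ∑ i, q i / κ ^ 2 * ⟪b i, (x : Space n)⟫ ^ 2 =
        (∑ k, ⟪a k, (x : Space n)⟫ ^ 2) / κ ^ 2 := by
      rw [hq, Finset.sum_div]
      exact Finset.sum_congr rfl fun i _ => by ring
    rw [h3, div_le_iff₀ (by positivity), hκ2]
    calc ∑ k, ⟪a k, (x : Space n)⟫ ^ 2 ≤ ∑ _k : Fin (n + 2), (((n : ℝ) + 1) * u) ^ 2 :=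
          Finset.sum_le_sum fun k _ => habs k
      _ = u ^ 2 * (((n : ℝ) + 1) ^ 2 * ((n : ℝ) + 2)) := by
          rw [Finset.sum_const, Finset.card_univ, nsmul_eq_mul, hcard]
          ring
  · obtain ⟨y₁, h₁, y₂, h₂, hD⟩ := exists_dist_eq_diam Ω.isCompact Ω.nonempty
    have hbound : ∀ y ∈ (Ω : Set (Space n)), ∀ x : Space n,
        |⟪y - z, x⟫| ≤ Real.sqrt ((n : ℝ) + 2) * Real.sqrt (q 0) * ‖x‖ := by
      intro y hy x
      refine abs_le_of_sq_le_sq ?_ (by positivity)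
      rw [mul_pow, mul_pow, hsq, Real.sq_sqrt (hqpos 0).le, mul_assoc]
      refine (hout y hy x).trans (mul_le_mul_of_nonneg_left ?_ (by positivity))
      rw [← b.sum_sq_inner_right x, Finset.mul_sum]
      exact Finset.sum_le_sum fun i _ =>
        mul_le_mul_of_nonneg_right (hqanti (Fin.zero_le i)) (sq_nonneg _)
    have h3 := le_of_abs_le (hbound y₁ h₁ (y₁ - y₂))
    have h4 := neg_le_of_abs_le (hbound y₂ h₂ (y₁ - y₂))
    have h5 : ⟪y₁ - z, y₁ - y₂⟫ - ⟪y₂ - z, y₁ - y₂⟫ = diam (Ω : Set (Space n)) ^ 2 := by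
      rw [← inner_sub_left, sub_sub_sub_cancel_right, real_inner_self_eq_norm_sq, hD]
    rw [hD] at h3 h4
    have h6 : 2 * (((n : ℝ) + 1) * ((n : ℝ) + 2)) * (Real.sqrt (q 0) / κ) =
        2 * (Real.sqrt ((n : ℝ) + 2) * Real.sqrt (q 0)) := by
      rw [← hκC]
      field_simp
    rw [h6]
    rcases (diam_nonneg (s := (Ω : Set (Space n)))).eq_or_lt with h0 | h0
    · rw [← h0]
      positivity
    · refine le_of_mul_le_mul_right ?_ h0
      nlinarith
  · set s : Fin (n + 1) → ℝ := fun i => Real.sqrt ((n : ℝ) + 2) * Real.sqrt (q i) with hs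
    have hspos : ∀ i, 0 < s i := fun i =>
      mul_pos (Real.sqrt_pos.2 (by positivity)) (Real.sqrt_pos.2 (hqpos i))
    have h1 : volume ((fun y => y + z) ⁻¹' (Ω : Set (Space n))) =
        volume (Ω : Set (Space n)) := measure_preimage_add_right volume z _
    have h2 := volume_le_of_sum_sq_le_one b hspos
      (S := (fun y => y + z) ⁻¹' (Ω : Set (Space n))) (fun y hy => ?_)
    · rw [h1, hΩ] at h2
      have h3 : (1 : ENNReal) ≤ ENNReal.ofReal (∏ i, s i) := by
        have hb0 := measure_closedBall_pos (volume : Measure (Space n)) 0 one_pos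
        have hbt : volume (closedBall (0 : Space n) 1) ≠ ⊤ := measure_closedBall_lt_top.ne
        refine (ENNReal.mul_le_mul_iff_left hb0.ne' hbt).1 ?_
        rwa [one_mul]
      rw [ENNReal.one_le_ofReal] at h3
      refine h3.trans_eq ?_
      have h4 : ∀ i, s i = (((n : ℝ) + 1) * ((n : ℝ) + 2)) * (Real.sqrt (q i) / κ) := fun i => by
        rw [← hκC]
        simp only [hs]
        field_simp
      simp only [h4]
      rw [Finset.prod_mul_distrib]
      simp
    · -- test the outer bound in the direction `∑ i, (⟪b i, y⟫ / q i) • b i`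
      set x : Space n := ∑ i, (⟪b i, y⟫ / q i) • b i with hx
      have hbx : ∀ i, ⟪b i, x⟫ = ⟪b i, y⟫ / q i := fun i => by
        rw [hx, b.orthonormal.inner_right_fintype]
      have h3 := hout (y + z) hy x
      rw [add_sub_cancel_right] at h3
      set N := ∑ i, ⟪b i, y⟫ ^ 2 / q i with hN
      have h4 : ⟪y, x⟫ = N := by
        rw [hx, inner_sum]
        refine Finset.sum_congr rfl fun i _ => ?_
        rw [real_inner_smul_right, real_inner_comm (b i) y]
        ring
      have h5 : ∑ i, q i * ⟪b i, x⟫ ^ 2 = N := by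
        refine Finset.sum_congr rfl fun i _ => ?_
        rw [hbx]
        have := (hqpos i).ne'
        field_simp
      rw [h4, h5] at h3
      have hN0 : 0 ≤ N := Finset.sum_nonneg fun i _ => div_nonneg (sq_nonneg _) (hqpos i).le
      have h6 : N ≤ (n : ℝ) + 2 := by
        by_contra hcon
        nlinarith
      have h7 : ∑ i, (⟪b i, y⟫ / s i) ^ 2 = N / ((n : ℝ) + 2) := by
        rw [hN, Finset.sum_div]
        refine Finset.sum_congr rfl fun i _ => ?_
        rw [div_pow, hs, mul_pow, hsq, Real.sq_sqrt (hqpos i).le]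
        have := (hqpos i).ne'
        field_simp
      rw [h7]
      exact (div_le_one (by positivity)).2 h6

end Ellipsoid

/-! ### Collars of great subspheres -/

section Collar

variable {n : ℕ}

instance isProbabilityMeasure_sphProb : IsProbabilityMeasure (sphProb n) := by
  have h0 : (volume : Measure (Space n)).toSphere Set.univ ≠ 0 := by
    rw [Measure.measure_univ_ne_zero]
    exact Measure.toSphere_ne_zero _
  constructor
  rw [sphProb, Measure.smul_apply, smul_eq_mul, ENNReal.inv_mul_cancel h0 (measure_ne_top _ _)]

lemma measurableSet_collar (L : Submodule ℝ (Space n)) (δ : ℝ) : MeasurableSet (collar L δ) := by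
  refine IsClosed.measurableSet ?_
  have : collar L δ = ⋂ (y : Sph n) (_ : (y : Space n) ∈ Lᗮ),
      {x : Sph n | ⟪(x : Space n), (y : Space n)⟫ ≤ δ} := by
    ext x
    simp [collar]
  rw [this]
  refine isClosed_biInter fun y _ => isClosed_le (by fun_prop) continuous_const

lemma mem_collar_span_singleton_orthogonal {z x : Sph n} {δ : ℝ} :
    x ∈ collar (ℝ ∙ (z : Space n))ᗮ δ ↔ |⟪(x : Space n), (z : Space n)⟫| ≤ δ := by
  have hz : ‖(z : Space n)‖ = 1 := by simp
  simp only [collar, Submodule.orthogonal_orthogonal, Set.mem_ofPred_eq]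
  constructor
  · intro h
    refine abs_le'.2 ⟨h z (Submodule.mem_span_singleton_self _), ?_⟩
    have := h (-z) (by
      rw [coe_neg_sphere]
      exact Submodule.neg_mem _ (Submodule.mem_span_singleton_self _))
    rwa [coe_neg_sphere, inner_neg_right] at this
  · intro h y hy
    obtain ⟨a, ha⟩ := Submodule.mem_span_singleton.1 hy
    have hy1 : ‖(y : Space n)‖ = 1 := by simp
    rw [← ha, norm_smul, hz, mul_one, Real.norm_eq_abs] at hy1
    rw [← ha, real_inner_smul_right]
    refine (le_abs_self _).trans ?_
    rwa [abs_mul, hy1, one_mul]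

lemma collar_subset_of_mem_orthogonal {L : Submodule ℝ (Space n)} {z : Sph n}
    (hz : (z : Space n) ∈ Lᗮ) (δ : ℝ) : collar L δ ⊆ collar (ℝ ∙ (z : Space n))ᗮ δ := by
  intro x hx
  rw [mem_collar_span_singleton_orthogonal]
  refine abs_le'.2 ⟨hx z hz, ?_⟩
  have := hx (-z) (by
    rw [coe_neg_sphere]
    exact Submodule.neg_mem _ hz)
  rwa [coe_neg_sphere, inner_neg_right] at this

lemma volume_slab_inter_ball_le (z : Sph n) {δ : ℝ} (hδ : 0 ≤ δ) :
    volume {y : Space n | |⟪y, (z : Space n)⟫| ≤ δ ∧ ‖y‖ ≤ 1} ≤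
      ENNReal.ofReal (2 ^ (n + 1) * δ) := by
  have hort : Orthonormal ℝ (({0} : Set (Fin (n + 1))).domRestrict fun _ => (z : Space n)) := by
    refine ⟨fun i => by simp, fun i j hij => ?_⟩
    exact absurd (Subtype.ext (i.2.trans j.2.symm)) hij
  obtain ⟨b, hb⟩ := hort.exists_orthonormalBasis_extension_of_card_eq
    (by simp : Module.finrank ℝ (Space n) = Fintype.card (Fin (n + 1)))
  have hb0 : b 0 = z := hb 0 rfl
  set c : Fin (n + 1) → ℝ := Fin.cons δ fun _ => 1 with hc
  have hp : MeasurePreserving (fun y : Space n => WithLp.ofLp (b.repr y)) volume volume :=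
    (PiLp.volume_preserving_ofLp (Fin (n + 1))).comp b.measurePreserving_repr
  have hsub : {y : Space n | |⟪y, (z : Space n)⟫| ≤ δ ∧ ‖y‖ ≤ 1} ⊆
      (fun y : Space n => WithLp.ofLp (b.repr y)) ⁻¹'
        (Set.univ.pi fun i => Set.Icc (-c i) (c i)) := by
    rintro y ⟨hy1, hy2⟩ i -
    refine abs_le.1 ?_
    simp only [b.repr_apply_apply]
    refine Fin.cases ?_ (fun j => ?_) i
    · rw [hb0, real_inner_comm]
      simpa [hc] using hy1
    · refine (abs_real_inner_le_norm _ _).trans ?_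
      rw [b.norm_eq_one, one_mul]
      simpa [hc] using hy2
  refine (measure_mono hsub).trans ?_
  rw [hp.measure_preimage (MeasurableSet.univ_pi fun i => measurableSet_Icc).nullMeasurableSet,
    volume_pi_pi]
  simp only [Real.volume_Icc]
  have hc0 : ∀ i, 0 ≤ c i := fun i => by
    refine Fin.cases ?_ (fun j => ?_) i <;> simp [hc, hδ]
  rw [← ENNReal.ofReal_prod_of_nonneg fun i _ => by linarith [hc0 i]]
  refine ENNReal.ofReal_le_ofReal (le_of_eq ?_)
  rw [Fin.prod_univ_succ]
  simp only [hc, Fin.cons_zero, Fin.cons_succ, Finset.prod_const, Finset.card_univ,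
    Fintype.card_fin]
  ring

/-- The measure of a collar of a great hypersphere is at most proportional to its width. -/
lemma exists_sphProb_collar_le (n : ℕ) : ∃ c : ℝ, 0 ≤ c ∧ ∀ (z : Sph n) (δ : ℝ), 0 ≤ δ →
    (sphProb n).real (collar (ℝ ∙ (z : Space n))ᗮ δ) ≤ c * δ := by
  set S := (volume : Measure (Space n)).toSphere with hS
  refine ⟨((S Set.univ)⁻¹).toReal * ((n + 1) * 2 ^ (n + 1)), by positivity, fun z δ hδ => ?_⟩
  have h1 : S (collar (ℝ ∙ (z : Space n))ᗮ δ) ≤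
      ENNReal.ofReal ((n + 1) * 2 ^ (n + 1) * δ) := by
    rw [hS, Measure.toSphere_apply' _ (measurableSet_collar _ _), mul_assoc,
      ENNReal.ofReal_mul (by positivity)]
    refine mul_le_mul' (le_of_eq ?_) ((measure_mono ?_).trans (volume_slab_inter_ball_le z hδ))
    · rw [show ((n : ℝ) + 1) = ((n + 1 : ℕ) : ℝ) by push_cast; rfl, ENNReal.ofReal_natCast]
      simp
    · rintro _ ⟨r, ⟨hr0, hr1⟩, _, ⟨x, hx, rfl⟩, rfl⟩
      rw [mem_collar_span_singleton_orthogonal] at hx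
      simp only [Set.mem_ofPred_eq, real_inner_smul_left, abs_mul, abs_of_pos hr0, norm_smul,
        Real.norm_eq_abs]
      refine ⟨?_, by simpa using hr1.le⟩
      nlinarith [abs_nonneg ⟪(x : Space n), (z : Space n)⟫]
  rw [measureReal_def, sphProb, Measure.smul_apply, smul_eq_mul, ENNReal.toReal_mul,
    mul_assoc]
  refine mul_le_mul_of_nonneg_left ?_ ENNReal.toReal_nonneg
  exact ENNReal.toReal_le_of_le_ofReal (by positivity) h1

lemma setIntegral_le_mul {f : Sph n → ℝ} {C : ℝ} (hf0 : ∀ x, 0 ≤ f x) (hfC : ∀ x, f x ≤ C)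
    (A : Set (Sph n)) : ∫ x in A, f x ∂(sphProb n) ≤ C * (sphProb n).real A := by
  refine (le_abs_self _).trans ?_
  rw [← Real.norm_eq_abs]
  refine norm_setIntegral_le_of_norm_le_const (measure_lt_top _ _) fun x _ => ?_
  rw [Real.norm_of_nonneg (hf0 x)]
  exact hfC x

lemma exists_mem_sphere_orthogonal {L : Submodule ℝ (Space n)} (hL : Module.finrank ℝ L ≤ n) :
    ∃ z : Sph n, (z : Space n) ∈ Lᗮ := by
  have hne : Lᗮ ≠ ⊥ := by
    intro h
    rw [Submodule.orthogonal_eq_bot_iff] at h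
    rw [h, finrank_top] at hL
    simp at hL
  obtain ⟨y, hy, hy0⟩ := Submodule.exists_mem_ne_zero_of_ne_bot hne
  refine ⟨⟨‖y‖⁻¹ • y, ?_⟩, Submodule.smul_mem _ _ hy⟩
  simp [norm_smul, hy0]

/-- For small widths the collars satisfy all three smallness conditions. -/
lemma exists_width {f : Sph n → ℝ} (hf : IsDensity f) {p τ : ℝ} (hp : 0 < (n : ℝ) + 1 + p)
    (hτ : τ ∈ Set.Ioo (0 : ℝ) 1) :
    ∃ δ ∈ Set.Ioo (0 : ℝ) 1,
      HyperplaneCondition f τ δ ∧ SubspaceCondition f τ δ ∧ PowerCondition p f τ δ := by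
  obtain ⟨C, hC⟩ := hf.bounded
  obtain ⟨c₀, hc₀, hc₀f⟩ := hf.inf_pos
  obtain ⟨c, hc, hcol⟩ := exists_sphProb_collar_le n
  have hf0 : ∀ x, 0 ≤ f x := fun x => hc₀.le.trans (hc₀f x)
  set q := ((n : ℝ) + 1) / ((n : ℝ) + 1 + p) with hq
  have hq0 : 0 < q := by positivity
  set K := max C (max (C ^ q) 1) with hK
  have hK0 : 0 < K := lt_max_of_lt_right (lt_max_of_lt_right one_pos)
  have hKC : C ≤ K := le_max_left _ _
  have hKq : C ^ q ≤ K := (le_max_left _ _).trans (le_max_right _ _)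
  have hτ0 := hτ.1
  have hτ1 : 0 < 1 - τ := sub_pos.2 hτ.2
  set B := min ((1 - τ) / (2 * ((n : ℝ) + 1))) (τ ^ q) with hB
  have hB0 : 0 < B := by positivity
  set δ := min (1 / 2) (B / (K * (c + 1))) with hδ
  have hδ0 : 0 < δ := by positivity
  have hδ1 : δ < 1 := (min_le_left _ _).trans_lt (by norm_num)
  have hKδ : K * (c * δ) ≤ B := by
    have h1 : δ ≤ B / (K * (c + 1)) := min_le_right _ _
    rw [le_div_iff₀ (by positivity)] at h1
    nlinarith [mul_pos hK0 hδ0]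
  have hint : ∀ (z : Sph n) (A : Set (Sph n)), A ⊆ collar (ℝ ∙ (z : Space n))ᗮ δ →
      ∀ g : Sph n → ℝ, (∀ x, 0 ≤ g x) → (∀ x, g x ≤ K) → ∫ x in A, g x ∂(sphProb n) ≤ B := by
    intro z A hA g hg0 hgK
    refine (setIntegral_le_mul hg0 hgK A).trans (le_trans ?_ hKδ)
    refine mul_le_mul_of_nonneg_left ?_ hK0.le
    exact (measureReal_mono hA).trans (hcol z δ hδ0.le)
  have hB1 : B < (1 - τ) / ((n : ℝ) + 1) := by
    refine (min_le_left _ _).trans_lt ?_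
    exact div_lt_div_of_pos_left hτ1 (by positivity)
      (by have : (0 : ℝ) ≤ n := n.cast_nonneg
          linarith)
  refine ⟨δ, ⟨hδ0, hδ1⟩, fun z => ?_, fun L hL1 hLn => ?_, fun z => ?_⟩
  · refine (hint z _ subset_rfl f hf0 fun x => (hC x).trans hKC).trans (hB1.le.trans ?_)
    exact div_le_self hτ1.le (by linarith [(n.cast_nonneg : (0 : ℝ) ≤ n)])
  · obtain ⟨z, hz⟩ := exists_mem_sphere_orthogonal hLn
    refine (hint z _ (collar_subset_of_mem_orthogonal hz δ) f hf0
      fun x => (hC x).trans hKC).trans_lt (hB1.trans_le ?_)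
    have : (1 : ℝ) ≤ Module.finrank ℝ L := by exact_mod_cast hL1
    exact div_le_div_of_nonneg_right (by nlinarith) (by positivity)
  · refine (hint z _ subset_rfl (fun x => f x ^ q) (fun x => Real.rpow_nonneg (hf0 x) _)
      fun x => ?_).trans (min_le_right _ _)
    exact (Real.rpow_le_rpow (hf0 x) (hC x) hq0.le).trans hKq

end Collar

/-! ### The entropy as an extremum of power integrals -/

section Entropy

variable {n : ℕ} {α : ℝ} {f : Sph n → ℝ} {K : Set (Space n)}

/-- Away from `α = 1`, scaling by `(α - 1) / α` undoes the factor in front of the logarithm. -/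
lemma exp_mul_entropyAt (hα0 : α ≠ 0) (hα1 : α ≠ 1) (z : Space n) :
    EReal.exp ((((α - 1) / α : ℝ) : EReal) * entropyAt α f K z) = powerIntegral α f K z := by
  have h1 : α - 1 ≠ 0 := sub_ne_zero.2 hα1
  rw [entropyAt, if_neg hα1, ← mul_assoc, ← EReal.coe_mul,
    show (α - 1) / α * (α / (α - 1)) = 1 by field_simp, EReal.coe_one, one_mul, ENNReal.exp_log]

lemma powerIntegral_le_exp_mul_entropy (hα : 1 < α) {z : Space n} (hz : z ∈ K) :
    powerIntegral α f K z ≤ EReal.exp ((((α - 1) / α : ℝ) : EReal) * entropy α f K) := by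
  rw [← exp_mul_entropyAt (by linarith) hα.ne' z]
  refine EReal.exp_monotone (mul_le_mul_of_nonneg_left ?_ ?_)
  · exact le_iSup₂ (f := fun z (_ : z ∈ K) => entropyAt α f K z) z hz
  · exact_mod_cast div_nonneg (by linarith) (by linarith)

lemma exp_mul_entropy_le_powerIntegral (hα0 : 0 < α) (hα1 : α < 1) {z : Space n} (hz : z ∈ K) :
    EReal.exp ((((α - 1) / α : ℝ) : EReal) * entropy α f K) ≤ powerIntegral α f K z := by
  rw [← exp_mul_entropyAt hα0.ne' hα1.ne z]
  have h1 : (((α - 1) / α : ℝ) : EReal) = -(((1 - α) / α : ℝ) : EReal) := by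
    rw [← EReal.coe_neg]
    congr 1
    ring
  rw [h1, EReal.neg_mul, EReal.neg_mul]
  refine EReal.exp_monotone (EReal.neg_le_neg_iff.2 (mul_le_mul_of_nonneg_left ?_ ?_))
  · exact le_iSup₂ (f := fun z (_ : z ∈ K) => entropyAt α f K z) z hz
  · exact_mod_cast div_nonneg (by linarith) hα0.le

end Entropy

/-! ### The power integrals away from a collar -/

section Density

variable {n : ℕ} {f : Sph n → ℝ}

lemma EntropyDiam.IsDensity.nonneg (hf : IsDensity f) (x : Sph n) : 0 ≤ f x := by
  obtain ⟨c, hc, h⟩ := hf.inf_pos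
  exact hc.le.trans (h x)

lemma EntropyDiam.IsDensity.integrable (hf : IsDensity f) : Integrable f (sphProb n) := by
  obtain ⟨C, hC⟩ := hf.bounded
  refine Integrable.of_bound hf.aemeasurable.aestronglyMeasurable C (.of_forall fun x => ?_)
  rw [Real.norm_of_nonneg (hf.nonneg x)]
  exact hC x

lemma EntropyDiam.IsDensity.lintegral_eq_one (hf : IsDensity f) :
    ∫⁻ x, ENNReal.ofReal (f x) ∂(sphProb n) = 1 := by
  rw [← ofReal_integral_eq_lintegral_ofReal hf.integrable (.of_forall hf.nonneg), hf.average,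
    ENNReal.ofReal_one]

lemma EntropyDiam.IsDensity.setLIntegral (hf : IsDensity f) (A : Set (Sph n)) :
    ∫⁻ x in A, ENNReal.ofReal (f x) ∂(sphProb n) = ENNReal.ofReal (∫ x in A, f x ∂(sphProb n)) :=
  (ofReal_integral_eq_lintegral_ofReal hf.integrable.integrableOn (.of_forall hf.nonneg)).symm

lemma EntropyDiam.IsDensity.setIntegral_compl (hf : IsDensity f) {A : Set (Sph n)} (hA : MeasurableSet A) :
    ∫ x in Aᶜ, f x ∂(sphProb n) = 1 - ∫ x in A, f x ∂(sphProb n) := by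
  have h := integral_add_compl hA hf.integrable
  rw [hf.average] at h
  linarith

end Density

section Power

variable {n : ℕ} {Ω : ConvexBody (Space n)}

lemma diam_pos (hΩ : HasUnitBallVolume Ω) : 0 < diam (Ω : Set (Space n)) := by
  refine diam_nonneg.lt_of_ne' fun h => ?_
  have h1 : (Ω : Set (Space n)).Subsingleton := fun x hx y hy =>
    dist_le_zero.1 (h ▸ dist_le_diam_of_mem Ω.isCompact.isBounded hx hy)
  have h2 : volume (Ω : Set (Space n)) = 0 := by
    obtain ⟨y, hy⟩ := Ω.nonempty
    rw [h1.eq_singleton_of_mem hy]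
    simp
  exact (volume_pos hΩ).ne' h2

lemma exists_diam_direction (hΩ : HasUnitBallVolume Ω) :
    ∃ (e : Sph n), ∃ y₁ ∈ (Ω : Set (Space n)), ∃ y₂ ∈ (Ω : Set (Space n)),
      y₁ - y₂ = diam (Ω : Set (Space n)) • (e : Space n) := by
  obtain ⟨y₁, h₁, y₂, h₂, hD⟩ := exists_dist_eq_diam Ω.isCompact Ω.nonempty
  have hD0 := diam_pos hΩ
  refine ⟨⟨(diam (Ω : Set (Space n)))⁻¹ • (y₁ - y₂), ?_⟩, y₁, h₁, y₂, h₂, ?_⟩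
  · rw [mem_sphere_zero_iff_norm, norm_smul, hD, norm_inv, Real.norm_of_nonneg hD0.le,
      inv_mul_cancel₀ hD0.ne']
  · rw [smul_inv_smul₀ hD0.ne']

/-- The case `α > 1`, with base point at the midpoint of a diameter: outside the collar orthogonal to
the diameter the support function is at least `δ * diam Ω / 2`. -/
lemma ofReal_le_powerIntegral_midpoint {α : ℝ} (hα : 1 < α) {f : Sph n → ℝ} (hf : IsDensity f)
    (hΩ : HasUnitBallVolume Ω) {δ τ : ℝ} (hδ : 0 < δ) (hτ : 0 < τ)
    (H : HyperplaneCondition f τ δ) :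
    ∃ z ∈ (Ω : Set (Space n)),
      ENNReal.ofReal ((1 / 2) ^ (1 - 1 / α) * τ * δ ^ (1 - 1 / α) *
        diam (Ω : Set (Space n)) ^ (1 - 1 / α)) ≤ powerIntegral α f (Ω : Set (Space n)) z := by
  obtain ⟨e, y₁, h₁, y₂, h₂, hD⟩ := exists_diam_direction hΩ
  have hD0 := diam_pos hΩ
  set D := diam (Ω : Set (Space n)) with hDdef
  set p := 1 - 1 / α with hp
  have hp0 : 0 ≤ p := by
    rw [hp, sub_nonneg]
    exact (div_le_one (by linarith)).2 hα.le
  set z : Space n := midpoint ℝ y₁ y₂ with hz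
  have hz1 : y₁ - z = (D / 2) • (e : Space n) := by
    rw [hz, left_sub_midpoint, hD, smul_smul, invOf_eq_inv]
    congr 1
    ring
  have hz2 : y₂ - z = -((D / 2) • (e : Space n)) := by
    rw [hz, right_sub_midpoint, ← neg_sub, hD, smul_neg, smul_smul, invOf_eq_inv]
    congr 2
    ring
  refine ⟨z, Ω.convex.midpoint_mem h₁ h₂, ?_⟩
  set A := collar (ℝ ∙ (e : Space n))ᗮ δ with hA
  have hAm : MeasurableSet A := measurableSet_collar _ _
  have hu : ∀ x ∈ Aᶜ, D / 2 * δ ≤ supportFn (Ω : Set (Space n)) z x := by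
    intro x hx
    rw [hA, Set.mem_compl_iff, mem_collar_span_singleton_orthogonal, not_le] at hx
    have g1 := inner_sub_le_supportFn Ω.isCompact z x h₁
    have g2 := inner_sub_le_supportFn Ω.isCompact z x h₂
    rw [hz1, real_inner_smul_left, real_inner_comm] at g1
    rw [hz2, inner_neg_left, real_inner_smul_left, real_inner_comm] at g2
    rcases lt_abs.1 hx with h | h <;> nlinarith
  have hmass : τ ≤ ∫ x in Aᶜ, f x ∂(sphProb n) := by
    rw [hf.setIntegral_compl hAm]
    linarith [H e]
  calc ENNReal.ofReal ((1 / 2) ^ p * τ * δ ^ p * D ^ p)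
      = ENNReal.ofReal τ * ENNReal.ofReal (D / 2 * δ) ^ p := by
        rw [ENNReal.ofReal_rpow_of_pos (by positivity), ← ENNReal.ofReal_mul hτ.le,
          Real.mul_rpow (by positivity) hδ.le, div_eq_mul_one_div D 2,
          Real.mul_rpow hD0.le (by norm_num)]
        congr 1
        ring
    _ ≤ ENNReal.ofReal (∫ x in Aᶜ, f x ∂(sphProb n)) * ENNReal.ofReal (D / 2 * δ) ^ p := by
        gcongr
    _ = ∫⁻ x in Aᶜ, ENNReal.ofReal (f x) * ENNReal.ofReal (D / 2 * δ) ^ p ∂(sphProb n) := by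
        rw [← hf.setLIntegral, lintegral_mul_const' _ _
          (ENNReal.rpow_ne_top_of_nonneg hp0 ENNReal.ofReal_ne_top)]
    _ ≤ ∫⁻ x in Aᶜ, ENNReal.ofReal (f x) *
          ENNReal.ofReal (supportFn (Ω : Set (Space n)) z x) ^ p ∂(sphProb n) := by
        refine setLIntegral_mono' hAm.compl fun x hx => ?_
        gcongr
        exact hu x hx
    _ ≤ _ := setLIntegral_le_lintegral _ _

lemma ennreal_rpow_anti {a b : ENNReal} (hab : a ≤ b) {t : ℝ} (ht : t ≤ 0) : b ^ t ≤ a ^ t := by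
  rw [← neg_neg t, ENNReal.rpow_neg, ENNReal.rpow_neg a]
  exact ENNReal.inv_le_inv.2 (ENNReal.rpow_le_rpow hab (by linarith))

/-- The contribution of a collar to the power integral at the centroid: Hölder's inequality and the
Blaschke–Santaló inequality. -/
lemma setLIntegral_collar_le {p : ℝ} (hp0 : p < 0)
    (hp1 : 0 < (n : ℝ) + 1 + p) {f : Sph n → ℝ} (hf : IsDensity f)
    (hΩ : HasUnitBallVolume Ω) {δ τ : ℝ} (hτ : 0 < τ) (H : PowerCondition p f τ δ) (e : Sph n) :
    ∫⁻ x in collar (ℝ ∙ (e : Space n))ᗮ δ, ENNReal.ofReal (f x) * ENNReal.ofReal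
      (supportFn (Ω : Set (Space n)) (centroid (Ω : Set (Space n))) x) ^ p ∂(sphProb n) ≤
      ENNReal.ofReal τ := by
  set A := collar (ℝ ∙ (e : Space n))ᗮ δ with hA
  set u := supportFn (Ω : Set (Space n)) (centroid (Ω : Set (Space n))) with hu
  have hum : Measurable u := (continuous_supportFn Ω.isCompact _).measurable
  have hn : (0 : ℝ) < (n : ℝ) + 1 := by positivity
  set q := ((n : ℝ) + 1) / ((n : ℝ) + 1 + p) with hq
  set q' := ((n : ℝ) + 1) / (-p) with hq'
  have hq0 : 0 < q := by positivity
  have hq'0 : 0 < q' := div_pos hn (by linarith)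
  have hconj : q.HolderConjugate q' := by
    refine ⟨?_, hq0, hq'0⟩
    rw [hq, hq', inv_div, inv_div, inv_one]
    field_simp
    ring
  have hhol := ENNReal.lintegral_mul_le_Lp_mul_Lq ((sphProb n).restrict A) hconj
    (f := fun x => ENNReal.ofReal (f x)) (g := fun x => ENNReal.ofReal (u x) ^ p)
    hf.aemeasurable.ennreal_ofReal.restrict (by fun_prop)
  have h1 : ∫⁻ x in A, ENNReal.ofReal (f x) ^ q ∂(sphProb n) ≤ ENNReal.ofReal τ ^ q := by
    obtain ⟨C, hC⟩ := hf.bounded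
    have hint : Integrable (fun x => f x ^ q) (sphProb n) := by
      refine Integrable.of_bound (hf.aemeasurable.pow_const q).aestronglyMeasurable (C ^ q)
        (.of_forall fun x => ?_)
      rw [Real.norm_of_nonneg (Real.rpow_nonneg (hf.nonneg x) _)]
      exact Real.rpow_le_rpow (hf.nonneg x) (hC x) hq0.le
    simp only [ENNReal.ofReal_rpow_of_nonneg (hf.nonneg _) hq0.le]
    rw [← ofReal_integral_eq_lintegral_ofReal hint.integrableOn
      (.of_forall fun x => Real.rpow_nonneg (hf.nonneg x) _),
      ENNReal.ofReal_rpow_of_pos hτ]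
    exact ENNReal.ofReal_le_ofReal (H e)
  have h2 : ∫⁻ x in A, (ENNReal.ofReal (u x) ^ p) ^ q' ∂(sphProb n) ≤ 1 := by
    have : p * q' = -((n : ℝ) + 1) := by
      have := hp0.ne
      rw [hq', div_neg, mul_neg, mul_div_cancel₀ _ this]
    simp only [← ENNReal.rpow_mul, this]
    exact (setLIntegral_le_lintegral _ _).trans (lintegral_supportFn_rpow_le_one hΩ)
  refine hhol.trans ?_
  calc _ ≤ (ENNReal.ofReal τ ^ q) ^ (1 / q) * 1 ^ (1 / q') := by
        gcongr
    _ = ENNReal.ofReal τ := by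
        rw [ENNReal.one_rpow, mul_one, ← ENNReal.rpow_mul, mul_one_div_cancel hq0.ne',
          ENNReal.rpow_one]

/-- The case `α < 1` for the power integral at the centroid: the collar contributes at most `τ`,
which is at most half of the integral, so the other half comes from the complement of the collar,
where the support function is at least `δ * diam Ω / (n + 2)`. -/
lemma diam_le_or_of_le_powerIntegral (hn : 1 ≤ n) {α p : ℝ} (hp : p = 1 - 1 / α) (hp0 : p < 0)
    (hp1 : 0 < (n : ℝ) + 1 + p) {f : Sph n → ℝ} (hf : IsDensity f)
    (hΩ : HasUnitBallVolume Ω) {δ τ : ℝ} (hδ : 0 < δ) (hτ : 0 < τ) (H : PowerCondition p f τ δ)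
    (hle : ENNReal.ofReal τ ≤
      2⁻¹ * powerIntegral α f (Ω : Set (Space n)) (centroid (Ω : Set (Space n)))) :
    diam (Ω : Set (Space n)) ≤ 16 * (n : ℝ) ^ 2 / δ ^ 2 ∨
      ENNReal.ofReal (diam (Ω : Set (Space n))) ≤
        (2⁻¹ * powerIntegral α f (Ω : Set (Space n)) (centroid (Ω : Set (Space n)))) ^ (2 / p) := by
  rw [or_iff_not_imp_left, not_le]
  intro hDlarge
  obtain ⟨e, y₁, h₁, y₂, h₂, hD⟩ := exists_diam_direction hΩ
  have hD0 := diam_pos hΩ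
  set D := diam (Ω : Set (Space n)) with hDdef
  set c := centroid (Ω : Set (Space n)) with hc
  set u := supportFn (Ω : Set (Space n)) c with hu
  set I := powerIntegral α f (Ω : Set (Space n)) c with hI
  set A := collar (ℝ ∙ (e : Space n))ᗮ δ with hA
  have hAm : MeasurableSet A := measurableSet_collar _ _
  have hn0 : (1 : ℝ) ≤ n := by exact_mod_cast hn
  set ℓ := D * δ / ((n : ℝ) + 2) with hℓ
  have hℓ0 : 0 < ℓ := by positivity
  have hul : ∀ x ∈ Aᶜ, ℓ ≤ u x := by
    intro x hx
    rw [hA, Set.mem_compl_iff, mem_collar_span_singleton_orthogonal, not_le] at hx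
    have g1 := inner_sub_le_mul_supportFn_centroid hΩ x h₁ h₂
    have g2 := inner_sub_le_mul_supportFn_centroid hΩ x h₂ h₁
    rw [hD, real_inner_smul_left, real_inner_comm] at g1
    rw [← neg_sub, hD, inner_neg_left, real_inner_smul_left, real_inner_comm] at g2
    rw [hℓ, div_le_iff₀' (by positivity)]
    rcases lt_abs.1 hx with h | h <;> nlinarith
  have hsplit : I = (∫⁻ x in A, ENNReal.ofReal (f x) * ENNReal.ofReal (u x) ^ p ∂(sphProb n)) +
      ∫⁻ x in Aᶜ, ENNReal.ofReal (f x) * ENNReal.ofReal (u x) ^ p ∂(sphProb n) := by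
    rw [lintegral_add_compl _ hAm, hI, powerIntegral, hp]
  have hin : ∫⁻ x in A, ENNReal.ofReal (f x) * ENNReal.ofReal (u x) ^ p ∂(sphProb n) ≤
      ENNReal.ofReal τ := setLIntegral_collar_le hp0 hp1 hf hΩ hτ H e
  have hout : ∫⁻ x in Aᶜ, ENNReal.ofReal (f x) * ENNReal.ofReal (u x) ^ p ∂(sphProb n) ≤
      ENNReal.ofReal ℓ ^ p := by
    calc _ ≤ ∫⁻ x in Aᶜ, ENNReal.ofReal (f x) * ENNReal.ofReal ℓ ^ p ∂(sphProb n) := by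
          refine setLIntegral_mono' hAm.compl fun x hx => ?_
          exact mul_le_mul_right (ennreal_rpow_anti (ENNReal.ofReal_le_ofReal (hul x hx)) hp0.le) _
      _ ≤ ∫⁻ x, ENNReal.ofReal (f x) * ENNReal.ofReal ℓ ^ p ∂(sphProb n) :=
          setLIntegral_le_lintegral _ _
      _ = ENNReal.ofReal ℓ ^ p := by
          rw [lintegral_mul_const', hf.lintegral_eq_one, one_mul]
          rw [ENNReal.ofReal_rpow_of_pos hℓ0]
          exact ENNReal.ofReal_ne_top
  have hℓt : ENNReal.ofReal ℓ ^ p ≠ ⊤ := by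
    rw [ENNReal.ofReal_rpow_of_pos hℓ0]
    exact ENNReal.ofReal_ne_top
  have hIt : I ≠ ⊤ := by
    rw [hsplit]
    exact ENNReal.add_ne_top.2 ⟨ne_top_of_le_ne_top ENNReal.ofReal_ne_top hin,
      ne_top_of_le_ne_top hℓt hout⟩
  have hhalf : 2⁻¹ * I ≤ ENNReal.ofReal ℓ ^ p := by
    have h1 : 2⁻¹ * I + 2⁻¹ * I ≤ 2⁻¹ * I + ENNReal.ofReal ℓ ^ p := by
      rw [← add_mul, ENNReal.inv_two_add_inv_two, one_mul]
      calc I = _ := hsplit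
        _ ≤ _ := add_le_add (hin.trans hle) hout
    exact (ENNReal.add_le_add_iff_left (ENNReal.mul_ne_top (by simp) hIt)).1 h1
  refine le_trans ?_ (ennreal_rpow_anti hhalf (div_nonpos_of_nonneg_of_nonpos two_pos.le hp0.le))
  rw [← ENNReal.rpow_mul, mul_div_cancel₀ _ hp0.ne, ENNReal.ofReal_rpow_of_pos hℓ0,
    Real.rpow_two]
  refine ENNReal.ofReal_le_ofReal ?_
  rw [div_lt_iff₀ (by positivity)] at hDlarge
  -- `(n + 2) ^ 2 ≤ 16 * n ^ 2` for `n ≥ 1`, so `ℓ ^ 2 ≥ D` once `D > 16 * n ^ 2 / δ ^ 2`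
  have h16 : ((n : ℝ) + 2) ^ 2 ≤ 16 * (n : ℝ) ^ 2 := by nlinarith
  rw [hℓ, div_pow, le_div_iff₀ (by positivity)]
  nlinarith [mul_le_mul_of_nonneg_left (h16.trans hDlarge.le) hD0.le]

end Power

/-! ### The logarithmic integral -/

section Log

variable {n : ℕ}

lemma integrable_density_mul_of_continuous {f g : Sph n → ℝ} (hf : IsDensity f)
    (hg : Continuous g) : Integrable (fun x => f x * g x) (sphProb n) := by
  obtain ⟨C, hC⟩ := isCompact_univ.exists_bound_of_continuousOn hg.continuousOn
  exact hf.integrable.mul_bdd hg.aestronglyMeasurable (.of_forall fun x => hC x trivial)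

lemma logIntegral_eq_coe_integral {f : Sph n → ℝ} (hf : IsDensity f) {K : Set (Space n)}
    (hK : IsCompact K) {z : Space n} (hu : ∀ x, 0 < supportFn K z x) :
    logIntegral f K z = ((∫ x, f x * Real.log (supportFn K z x) ∂(sphProb n) : ℝ) : EReal) := by
  have hint := integrable_density_mul_of_continuous hf
    ((continuous_supportFn hK z).log fun x => (hu x).ne')
  have hlog : ∀ x, ENNReal.log (ENNReal.ofReal (supportFn K z x)) =
      ((Real.log (supportFn K z x) : ℝ) : EReal) := fun x => ENNReal.log_ofReal_of_pos (hu x)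
  have h1 : ∀ x, ENNReal.ofReal (f x) * (ENNReal.log (ENNReal.ofReal (supportFn K z x))).toENNReal =
      ENNReal.ofReal (f x * Real.log (supportFn K z x)) := fun x => by
    rw [hlog, EReal.toENNReal_of_ne_top (EReal.coe_ne_top _), EReal.toReal_coe,
      ENNReal.ofReal_mul (hf.nonneg x)]
  have h2 : ∀ x, ENNReal.ofReal (f x) *
      (-ENNReal.log (ENNReal.ofReal (supportFn K z x))).toENNReal =
      ENNReal.ofReal (-(f x * Real.log (supportFn K z x))) := fun x => by
    rw [hlog, ← EReal.coe_neg, EReal.toENNReal_of_ne_top (EReal.coe_ne_top _), EReal.toReal_coe,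
      ← mul_neg, ENNReal.ofReal_mul (hf.nonneg x)]
  rw [logIntegral, integral_eq_lintegral_pos_part_sub_lintegral_neg_part hint]
  simp only [h1, h2]
  have t1 : ∫⁻ x, ENNReal.ofReal (f x * Real.log (supportFn K z x)) ∂(sphProb n) ≠ ⊤ :=
    hint.lintegral_lt_top.ne
  have t2 : ∫⁻ x, ENNReal.ofReal (-(f x * Real.log (supportFn K z x))) ∂(sphProb n) ≠ ⊤ :=
    hint.neg.lintegral_lt_top.ne
  have hcoe : ∀ a : ENNReal, a ≠ ⊤ → ((a.toReal : ℝ) : EReal) = a := fun a ha => by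
    lift a to NNReal using ha
    rfl
  rw [EReal.coe_sub, hcoe _ t1, hcoe _ t2]

end Log

/-! ### Collars of the flag of an ellipsoid -/

section Flag

variable {n : ℕ}

lemma collar_mono {L L' : Submodule ℝ (Space n)} (h : L ≤ L') (δ : ℝ) :
    collar L δ ⊆ collar L' δ := fun _ hx y hy => hx y (Submodule.orthogonal_le h hy)

lemma collar_bot {δ : ℝ} (hδ : δ < 1) : collar (⊥ : Submodule ℝ (Space n)) δ = ∅ := by
  refine Set.eq_empty_of_forall_notMem fun x hx => ?_
  have := hx x (by simp)
  rw [real_inner_self_eq_norm_sq] at this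
  simp at this
  linarith

lemma finrank_span_image_Ioi (b : OrthonormalBasis (Fin (n + 1)) ℝ (Space n)) (i : Fin (n + 1)) :
    Module.finrank ℝ (Submodule.span ℝ (b '' Set.Ioi i)) = n - i := by
  have hli : LinearIndependent ℝ fun k : Set.Ioi i => b k :=
    b.orthonormal.linearIndependent.comp _ Subtype.val_injective
  have h := finrank_span_eq_card hli
  rw [show Set.range (fun k : Set.Ioi i => b k) = b '' Set.Ioi i by
    rw [Set.image_eq_range]] at h
  rw [h, Fintype.card_ofFinset (Finset.Ioi i) (by simp)]
  simp

/-- Away from the collar of the span of the short axes of an ellipsoid, the support function of the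
ellipsoid is bounded from below by its shortest remaining axis. -/
lemma mul_le_of_notMem_collar (b : OrthonormalBasis (Fin (n + 1)) ℝ (Space n))
    {r : Fin (n + 1) → ℝ} (hr : Antitone r) (hr0 : ∀ i, 0 < r i) {δ u : ℝ} (hu : 0 ≤ u)
    {x : Sph n} (hx : ∑ i, r i ^ 2 * ⟪b i, (x : Space n)⟫ ^ 2 ≤ u ^ 2) {i : Fin (n + 1)}
    (hxi : x ∉ collar (Submodule.span ℝ (b '' Set.Ioi i)) δ) : δ * r i ≤ u := by
  simp only [collar, Set.mem_ofPred_eq, not_forall, not_le] at hxi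
  obtain ⟨y, hy, hxy⟩ := hxi
  have hy0 : ∀ k, i < k → ⟪b k, (y : Space n)⟫ = 0 := fun k hk =>
    Submodule.inner_right_of_mem_orthogonal
      (Submodule.subset_span (Set.mem_image_of_mem b (Set.mem_Ioi.2 hk))) hy
  have h1 : r i * ⟪(x : Space n), (y : Space n)⟫ =
      ∑ k, (r k * ⟪b k, (x : Space n)⟫) * (r i / r k * ⟪b k, (y : Space n)⟫) := by
    rw [← b.sum_inner_mul_inner, Finset.mul_sum]
    refine Finset.sum_congr rfl fun k _ => ?_
    rw [real_inner_comm]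
    have := (hr0 k).ne'
    field_simp
  have h2 : (r i * ⟪(x : Space n), (y : Space n)⟫) ^ 2 ≤ u ^ 2 := by
    rw [h1]
    refine (Finset.sum_mul_sq_le_sq_mul_sq _ _ _).trans ?_
    have h3 : ∑ k, (r k * ⟪b k, (x : Space n)⟫) ^ 2 ≤ u ^ 2 := by simpa only [mul_pow] using hx
    have h4 : ∑ k, (r i / r k * ⟪b k, (y : Space n)⟫) ^ 2 ≤ 1 := by
      have h5 : ∑ k, ⟪b k, (y : Space n)⟫ ^ 2 = 1 := by
        rw [b.sum_sq_inner_right]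
        simp
      refine (Finset.sum_le_sum fun k _ => ?_).trans_eq h5
      rcases lt_or_ge i k with hk | hk
      · simp [hy0 k hk]
      · rw [mul_pow]
        refine mul_le_of_le_one_left (sq_nonneg _) ?_
        exact pow_le_one₀ (div_nonneg (hr0 i).le (hr0 k).le) ((div_le_one (hr0 k)).2 (hr hk))
    calc _ ≤ u ^ 2 * 1 := mul_le_mul h3 h4 (Finset.sum_nonneg fun k _ => sq_nonneg _) (sq_nonneg _)
      _ = u ^ 2 := mul_one _
  have h3 := le_of_abs_le (abs_le_of_sq_le_sq h2 hu)
  nlinarith [hr0 i]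

/-- If `P` holds from some index `j` on, up to `m`, then the sum telescopes to `l j - l m`. -/
lemma add_sum_ite_sub_le {l : ℕ → ℝ} {P : ℕ → Prop} [DecidablePred P]
    (hP : ∀ j, P j → P (j + 1)) {M : ℝ} (m : ℕ) (hm : P m) (hM : ∀ j ≤ m, P j → l j ≤ M) :
    l m + ∑ j ∈ Finset.range m, (if P j then l j - l (j + 1) else 0) ≤ M := by
  induction m with
  | zero => simpa using hM 0 le_rfl hm
  | succ m ih =>
    rw [Finset.sum_range_succ]
    by_cases h : P m
    · rw [if_pos h]
      linarith [ih h fun j hj => hM j (hj.trans m.le_succ)]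
    · have hall : ∀ j ≤ m, ¬ P j := fun j hj hPj =>
        h (Nat.le_induction hPj (fun k _ hk => hP k hk) m hj)
      rw [if_neg h, Finset.sum_eq_zero fun j hj =>
        if_neg (hall j (Finset.mem_range.1 hj).le)]
      simpa using hM (m + 1) le_rfl hm

/-- Summation by parts. -/
lemma sum_sub_mul_eq (l : ℕ → ℝ) (m : ℕ) :
    ∑ j ∈ Finset.range m, (l j - l (j + 1)) * ((m : ℝ) - j) =
      ((m : ℝ) + 1) * l 0 - ∑ i ∈ Finset.range (m + 1), l i := by
  induction m with
  | zero => simp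
  | succ m ih =>
    have h : ∑ j ∈ Finset.range (m + 1), (l j - l (j + 1)) * (((m + 1 : ℕ) : ℝ) - j) =
        ∑ j ∈ Finset.range (m + 1), (l j - l (j + 1)) * ((m : ℝ) - j) +
          ∑ j ∈ Finset.range (m + 1), (l j - l (j + 1)) := by
      rw [← Finset.sum_add_distrib]
      refine Finset.sum_congr rfl fun j _ => ?_
      push_cast
      ring
    rw [h, Finset.sum_range_sub', Finset.sum_range_succ, ih, sub_self, mul_zero,
      Finset.sum_range_succ _ (m + 1)]
    push_cast
    ring

end Flag

/-! ### The case of the logarithm -/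

section LogCase

variable {n : ℕ} {Ω : ConvexBody (Space n)}

/-- The logarithms of the axes of the ellipsoid enter with the masses of the differences of
successive collars; summation by parts turns the bounds on the masses of the collars into a bound
by the longest axis and the product of all axes. -/
lemma le_integral_mul_log {f : Sph n → ℝ} (hf : IsDensity f) {δ τ : ℝ}
    (hδ : δ ∈ Set.Ioo (0 : ℝ) 1) (H : SubspaceCondition f τ δ)
    (b : OrthonormalBasis (Fin (n + 1)) ℝ (Space n)) {r : Fin (n + 1) → ℝ} (hr : Antitone r)
    (hr0 : ∀ i, 0 < r i) {u : Sph n → ℝ} (hu : Continuous u) (hu0 : ∀ x, 0 < u x)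
    (hru : ∀ x : Sph n, ∑ i, r i ^ 2 * ⟪b i, (x : Space n)⟫ ^ 2 ≤ u x ^ 2) :
    Real.log δ + τ * Real.log (r 0) + (1 - τ) / ((n : ℝ) + 1) * ∑ i, Real.log (r i) ≤
      ∫ x, f x * Real.log (u x) ∂(sphProb n) := by
  classical
  -- the axes are indexed by `ℕ`, constant from `n` on; only the indices `0, …, n` matter
  set k : ℕ → Fin (n + 1) := fun j => ⟨min j n, by omega⟩ with hk
  have hkmono : ∀ j, k j ≤ k (j + 1) := fun j => by
    rw [Fin.le_def]
    simp only [hk]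
    omega
  set l : ℕ → ℝ := fun j => Real.log (r (k j)) with hl
  have hd : ∀ j, 0 ≤ l j - l (j + 1) := fun j =>
    sub_nonneg.2 (Real.log_le_log (hr0 _) (hr (hkmono j)))
  set A : ℕ → Set (Sph n) := fun j => collar (Submodule.span ℝ (b '' Set.Ioi (k j))) δ with hA
  have hAm : ∀ j, MeasurableSet (A j) := fun j => measurableSet_collar _ _
  have hAn : A n = ∅ := by
    have : Set.Ioi (k n) = ∅ := by
      refine Set.eq_empty_of_forall_notMem fun i hi => ?_
      rw [Set.mem_Ioi, Fin.lt_def] at hi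
      simp only [hk] at hi
      omega
    simp only [hA]
    rw [this, Set.image_empty, Submodule.span_empty, collar_bot hδ.2]
  have hpt : ∀ x, Real.log δ + l n + ∑ j ∈ Finset.range n, (A j)ᶜ.indicator
      (fun _ => l j - l (j + 1)) x ≤ Real.log (u x) := by
    intro x
    have h := add_sum_ite_sub_le (l := l) (P := fun j => x ∉ A j) (M := Real.log (u x) - Real.log δ)
      (fun j hj hj' => hj (collar_mono (Submodule.span_mono
        (Set.image_mono (Set.Ioi_subset_Ioi (hkmono j)))) δ hj')) n (by simp [hAn])
      (fun j _ hj => by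
        have h1 := mul_le_of_notMem_collar b hr hr0 (hu0 x).le (hru x) hj
        have h2 := Real.log_le_log (mul_pos hδ.1 (hr0 _)) h1
        rw [Real.log_mul hδ.1.ne' (hr0 _).ne'] at h2
        simp only [hl]
        linarith)
    simp only [Set.indicator_apply, Set.mem_compl_iff]
    linarith
  have hintj : ∀ j, Integrable (fun x => f x * (A j)ᶜ.indicator (fun _ => l j - l (j + 1)) x)
      (sphProb n) := fun j => by
    refine hf.integrable.mul_bdd (c := l j - l (j + 1))
      ((measurable_const.indicator (hAm j).compl).aestronglyMeasurable) (.of_forall fun x => ?_)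
    exact (norm_indicator_le_norm_self _ _).trans_eq (Real.norm_of_nonneg (hd j))
  have hvalj : ∀ j, ∫ x, f x * (A j)ᶜ.indicator (fun _ => l j - l (j + 1)) x ∂(sphProb n) =
      (l j - l (j + 1)) * (1 - ∫ x in A j, f x ∂(sphProb n)) := fun j => by
    rw [← hf.setIntegral_compl (hAm j), ← integral_const_mul, ← integral_indicator (hAm j).compl]
    refine integral_congr_ae (.of_forall fun x => ?_)
    by_cases hx : x ∈ (A j)ᶜ
    · simp only [Set.indicator_of_mem hx]
      ring
    · simp only [Set.indicator_of_notMem hx, mul_zero]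
  have hmass : ∀ j ∈ Finset.range n,
      ∫ x in A j, f x ∂(sphProb n) ≤ (1 - τ) * ((n : ℝ) - j) / ((n : ℝ) + 1) := fun j hj => by
    have hjn := Finset.mem_range.1 hj
    have hrank := finrank_span_image_Ioi b (k j)
    have hkj : ((k j : Fin (n + 1)) : ℕ) = j := min_eq_left hjn.le
    rw [hkj] at hrank
    have h := (H (Submodule.span ℝ (b '' Set.Ioi (k j))) (by omega) (by omega)).le
    rwa [hrank, Nat.cast_sub hjn.le] at h
  have hS : ∑ i ∈ Finset.range (n + 1), l i = ∑ i, Real.log (r i) := by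
    rw [Finset.sum_range]
    refine Finset.sum_congr rfl fun i _ => ?_
    simp only [hl, hk]
    congr 2
    ext
    exact min_eq_left (Nat.lt_succ_iff.1 i.2)
  have hl0 : l 0 = Real.log (r 0) := by
    simp only [hl, hk]
    congr 2
  have hint1 : Integrable (fun x => f x * (Real.log δ + l n)) (sphProb n) :=
    hf.integrable.mul_const _
  have hint2 : Integrable (fun x => ∑ j ∈ Finset.range n,
      f x * (A j)ᶜ.indicator (fun _ => l j - l (j + 1)) x) (sphProb n) :=
    integrable_finsetSum _ fun j _ => hintj j
  calc Real.log δ + τ * Real.log (r 0) + (1 - τ) / ((n : ℝ) + 1) * ∑ i, Real.log (r i)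
      = (Real.log δ + l n) + ∑ j ∈ Finset.range n,
          (l j - l (j + 1)) * (1 - (1 - τ) * ((n : ℝ) - j) / ((n : ℝ) + 1)) := by
        have h1 : ∀ j : ℕ, (l j - l (j + 1)) * (1 - (1 - τ) * ((n : ℝ) - j) / ((n : ℝ) + 1)) =
            (l j - l (j + 1)) -
              (1 - τ) / ((n : ℝ) + 1) * ((l j - l (j + 1)) * ((n : ℝ) - j)) := fun j => by ring
        simp only [h1]
        rw [Finset.sum_sub_distrib, Finset.sum_range_sub', ← Finset.mul_sum, sum_sub_mul_eq, hS,
          hl0]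
        field_simp
        ring
    _ ≤ (Real.log δ + l n) + ∑ j ∈ Finset.range n,
          (l j - l (j + 1)) * (1 - ∫ x in A j, f x ∂(sphProb n)) := by
        gcongr with j hj
        · exact hd j
        · exact hmass j hj
    _ = ∫ x, (f x * (Real.log δ + l n) + ∑ j ∈ Finset.range n,
          f x * (A j)ᶜ.indicator (fun _ => l j - l (j + 1)) x) ∂(sphProb n) := by
        rw [integral_add hint1 hint2, integral_mul_const, hf.average, one_mul,
          integral_finsetSum _ fun j _ => hintj j]
        simp only [hvalj]
    _ ≤ ∫ x, f x * Real.log (u x) ∂(sphProb n) := by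
        refine integral_mono (hint1.add hint2)
          (integrable_density_mul_of_continuous hf (hu.log fun x => (hu0 x).ne')) fun x => ?_
        simp only
        rw [← Finset.mul_sum, ← mul_add]
        exact mul_le_mul_of_nonneg_left (hpt x) (hf.nonneg x)

/-- The case `α = 1`, with the base point of the ellipsoid. The constant `4` comes from
`2 * (n + 1) * (n + 2) ≤ (n + 1) ^ 4` for `n ≥ 1`. -/
lemma le_entropy_one (hn : 1 ≤ n) {f : Sph n → ℝ} (hf : IsDensity f) (hΩ : HasUnitBallVolume Ω)
    {δ τ : ℝ} (hδ : δ ∈ Set.Ioo (0 : ℝ) 1) (hτ : τ ∈ Set.Ioo (0 : ℝ) 1)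
    (H : SubspaceCondition f τ δ) :
    ((τ * Real.log (diam (Ω : Set (Space n))) + Real.log δ
      - 4 * Real.log ((n : ℝ) + 1) : ℝ) : EReal) ≤ entropy 1 f (Ω : Set (Space n)) := by
  obtain ⟨z, hz, b, r, hr, hr0, hru, hdiam, hprod⟩ := exists_ellipsoid hΩ
  have hu0 : ∀ x, 0 < supportFn (Ω : Set (Space n)) z x := by
    intro x
    refine (supportFn_nonneg Ω.isCompact hz x).lt_of_ne' fun h => ?_
    have h1 := hru x
    rw [h] at h1
    have h2 : ∑ i, r (Fin.last n) ^ 2 * ⟪b i, (x : Space n)⟫ ^ 2 ≤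
        ∑ i, r i ^ 2 * ⟪b i, (x : Space n)⟫ ^ 2 := Finset.sum_le_sum fun i _ =>
      mul_le_mul_of_nonneg_right (pow_le_pow_left₀ (hr0 _).le (hr (Fin.le_last i)) 2) (sq_nonneg _)
    rw [← Finset.mul_sum, b.sum_sq_inner_right] at h2
    have h3 := pow_pos (hr0 (Fin.last n)) 2
    simp at h2 h1
    linarith
  have hmain := le_integral_mul_log hf hδ H b hr hr0 (continuous_supportFn Ω.isCompact z) hu0 hru
  have hle : logIntegral f (Ω : Set (Space n)) z ≤ entropy 1 f (Ω : Set (Space n)) := by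
    refine le_trans (le_of_eq ?_)
      (le_iSup₂ (f := fun z (_ : z ∈ (Ω : Set (Space n))) => entropyAt 1 f Ω z) z hz)
    simp [entropyAt]
  rw [logIntegral_eq_coe_integral hf Ω.isCompact hu0] at hle
  refine le_trans (EReal.coe_le_coe_iff.2 (le_trans ?_ hmain)) hle
  have hn1 : (1 : ℝ) ≤ n := by exact_mod_cast hn
  set C := ((n : ℝ) + 1) * ((n : ℝ) + 2) with hC
  have hC0 : 0 < C := by positivity
  have hD0 := diam_pos hΩ
  have h1 : Real.log (diam (Ω : Set (Space n))) ≤ Real.log (2 * C) + Real.log (r 0) := by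
    rw [← Real.log_mul (by positivity) (hr0 0).ne']
    exact Real.log_le_log hD0 hdiam
  have h2 : -Real.log C ≤ (∑ i, Real.log (r i)) / ((n : ℝ) + 1) := by
    have h := Real.log_nonneg hprod
    rw [Real.log_mul (by positivity) (Finset.prod_pos fun i _ => hr0 i).ne', Real.log_pow,
      Real.log_prod fun i _ => (hr0 i).ne'] at h
    rw [le_div_iff₀ (by positivity)]
    push_cast at h
    linarith
  have h3 : Real.log C ≤ Real.log (2 * C) := Real.log_le_log hC0 (by linarith)
  have h4 : Real.log (2 * C) ≤ 4 * Real.log ((n : ℝ) + 1) := by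
    have : (4 : ℝ) * Real.log ((n : ℝ) + 1) = Real.log (((n : ℝ) + 1) ^ 4) := by
      rw [Real.log_pow]
      norm_num
    rw [this]
    refine Real.log_le_log (by positivity) ?_
    rw [hC]
    have h5 : 2 * ((n : ℝ) + 2) ≤ ((n : ℝ) + 1) ^ 3 := by nlinarith [sq_nonneg (n : ℝ)]
    nlinarith
  have h5 := mul_le_mul_of_nonneg_left h1 hτ.1.le
  have h6 := mul_le_mul_of_nonneg_left (h3.trans h4) (sub_pos.2 hτ.2).le
  have h7 := mul_le_mul_of_nonneg_left h2 (sub_pos.2 hτ.2).le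
  have h8 := mul_le_mul_of_nonneg_left h4 hτ.1.le
  rw [div_mul_eq_mul_div, mul_div_assoc]
  linarith

end LogCase

theorem theorem2p1 (n : ℕ) (hn : 1 ≤ n) (α : ℝ) (hα : 1 / ((n : ℝ) + 2) < α) :
    -- the case `α > 1`
    (1 < α → ∃ γ : ℝ, 0 < γ ∧
      ∀ f : Sph n → ℝ, IsDensity f →
      ∀ Ω : ConvexBody (Space n), HasUnitBallVolume Ω →
      ∀ δ ∈ Set.Ioo (0 : ℝ) 1, ∀ τ ∈ Set.Ioo (0 : ℝ) 1,
        HyperplaneCondition f τ δ →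
          ENNReal.ofReal (γ * τ * δ ^ (1 - 1 / α) * diam (Ω : Set (Space n)) ^ (1 - 1 / α)) ≤
            EReal.exp ((((α - 1) / α : ℝ) : EReal) * entropy α f Ω)) ∧
    -- the case `α = 1`
    (α = 1 →
      ∀ f : Sph n → ℝ, IsDensity f →
      ∀ Ω : ConvexBody (Space n), HasUnitBallVolume Ω →
      ∀ δ ∈ Set.Ioo (0 : ℝ) 1, ∀ τ ∈ Set.Ioo (0 : ℝ) 1,
        SubspaceCondition f τ δ →
          ((τ * Real.log (diam (Ω : Set (Space n))) + Real.log δ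
              - 4 * Real.log ((n : ℝ) + 1) : ℝ) : EReal) ≤ entropy 1 f Ω) ∧
    -- the case `1 / (n + 2) < α < 1`
    (α < 1 → ∀ p : ℝ, p = 1 - 1 / α →
      ∀ f : Sph n → ℝ, IsDensity f →
      ∀ Ω : ConvexBody (Space n), HasUnitBallVolume Ω →
      ∀ δ ∈ Set.Ioo (0 : ℝ) 1, ∀ τ ∈ Set.Ioo (0 : ℝ) 1,
        PowerCondition p f τ δ →
          (ENNReal.ofReal τ ≤ 2⁻¹ * powerIntegral α f Ω (centroid (Ω : Set (Space n))) →
            diam (Ω : Set (Space n)) ≤ 16 * (n : ℝ) ^ 2 / δ ^ 2 ∨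
            ENNReal.ofReal (diam (Ω : Set (Space n))) ≤
              (2⁻¹ * powerIntegral α f Ω (centroid (Ω : Set (Space n)))) ^ (2 / p)) ∧
          (ENNReal.ofReal τ ≤ 2⁻¹ * EReal.exp ((((α - 1) / α : ℝ) : EReal) * entropy α f Ω) →
            diam (Ω : Set (Space n)) ≤ 16 * (n : ℝ) ^ 2 / δ ^ 2 ∨
            ENNReal.ofReal (diam (Ω : Set (Space n))) ≤
              (2⁻¹ * EReal.exp ((((α - 1) / α : ℝ) : EReal) * entropy α f Ω)) ^ (2 / p))) ∧
    -- the conditions are satisfied for some `δ`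
    (∀ f : Sph n → ℝ, IsDensity f → ∀ τ ∈ Set.Ioo (0 : ℝ) 1,
      ∃ δ ∈ Set.Ioo (0 : ℝ) 1,
        HyperplaneCondition f τ δ ∧ SubspaceCondition f τ δ ∧
        PowerCondition (1 - 1 / α) f τ δ ∧
        (α < 1 → ∀ Ω : ConvexBody (Space n), HasUnitBallVolume Ω →
          ENNReal.ofReal τ ≤ 2⁻¹ * EReal.exp ((((α - 1) / α : ℝ) : EReal) * entropy α f Ω) →
            ENNReal.ofReal τ ≤ 2⁻¹ * powerIntegral α f Ω (centroid (Ω : Set (Space n))))) := by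
  have hn2 : (0 : ℝ) < (n : ℝ) + 2 := by positivity
  have hα0 : 0 < α := lt_trans (by positivity) hα
  have hexp : 0 < (n : ℝ) + 1 + (1 - 1 / α) := by
    have h : 1 / α < (n : ℝ) + 2 := by
      rwa [div_lt_iff₀ hn2, mul_comm, ← div_lt_iff₀ hα0] at hα
    linarith
  have hneg : α < 1 → 1 - 1 / α < 0 := fun hα1 => by
    have := (one_lt_div hα0).2 hα1
    linarith
  -- for `α < 1` the exponential of the scaled entropy is an infimum over all base points
  have hinf : α < 1 → ∀ (f : Sph n → ℝ) (Ω : ConvexBody (Space n)), HasUnitBallVolume Ω →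
      2⁻¹ * EReal.exp ((((α - 1) / α : ℝ) : EReal) * entropy α f Ω) ≤
        2⁻¹ * powerIntegral α f Ω (centroid (Ω : Set (Space n))) := fun hα1 f Ω hΩ =>
    mul_le_mul_right (exp_mul_entropy_le_powerIntegral hα0 hα1 (centroid_mem hΩ)) _
  refine ⟨fun hα1 => ?_, fun _ f hf Ω hΩ δ hδ τ hτ H => le_entropy_one hn hf hΩ hδ hτ H,
    fun hα1 p hp f hf Ω hΩ δ hδ τ hτ H => ?_, fun f hf τ hτ => ?_⟩
  · refine ⟨(1 / 2) ^ (1 - 1 / α), by positivity, fun f hf Ω hΩ δ hδ τ hτ H => ?_⟩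
    obtain ⟨z, hz, hle⟩ := ofReal_le_powerIntegral_midpoint hα1 hf hΩ hδ.1 hτ.1 H
    exact hle.trans (powerIntegral_le_exp_mul_entropy hα1 hz)
  · have hp0 : p < 0 := hp ▸ hneg hα1
    have hmain := diam_le_or_of_le_powerIntegral hn hp hp0 (hp ▸ hexp) hf hΩ hδ.1 hτ.1 H
    refine ⟨hmain, fun hle => ?_⟩
    exact (hmain (hle.trans (hinf hα1 f Ω hΩ))).imp_right fun h => h.trans
      (ennreal_rpow_anti (hinf hα1 f Ω hΩ) (div_nonpos_of_nonneg_of_nonpos two_pos.le hp0.le))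
  · obtain ⟨δ, hδ, h1, h2, h3⟩ := exists_width hf hexp hτ
    exact ⟨δ, hδ, h1, h2, h3, fun hα1 Ω hΩ hle => hle.trans (hinf hα1 f Ω hΩ)⟩
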